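/- Setting. Let $\mathcal X$ be a second countable smooth $d$-dimensional Riemannian manifold (possibly with boundary), $d\ge 1$, with Riemannian distance $\operatorname{dist}$ and Riemannian volume $m$. Let $f:\mathcal X\to\mathcal X$ be measurable and let $\nu$ be an $f$-invariant ergodic Borel probability measure with a density $\rho\in L^{1+\delta}(m)$ for some $\delta>0$. Suppose that $f$ is non-uniformly expanding: there is $\lambda_0>0$ such that at $\nu$-a.e. $x$ all iterates $f^n$ are differentiable and $\lim_{n\to\infty}\frac1n\log\|Df^n(x)v\|$ exists and is at least $\lambda_0$ for all $0\ne v\in T_x\mathcal X$. For $\tilde x\in\mathcal X$ put $$\phi(x)=-\log\operatorname{dist}(x,\tilde x),\qquad M_n=\max_{0\le i<n}\phi\circ f^i,\qquad u_n=u_n(u)=\frac ud+\frac1d\log n,$$ $$\tau_n(u)=n\,\nu\{\phi\ge u_n\},\qquad G_{\sqrt n}(u)=\Bigl(1-\frac{\tau_n(u)}{\sqrt n}\Bigr)^{\sqrt n}.$$ (H1) There is a decreasing sequence $\Theta(j)\to0$ such that for all bounded Lipschitz $\varphi_1$, all $\varphi_2\in L^\infty(\nu)$ and all $j$, $$\Bigl|\int\varphi_1\cdot\varphi_2\circ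 f^j\,d\nu-\int\varphi_1\,d\nu\int\varphi_2\,d\nu\Bigr|\le\Theta(j)\,\|\varphi_1\|_{\mathrm{Lip}}\,\|\varphi_2\|_{L^\infty},$$ where $\|\varphi_1\|_{\mathrm{Lip}}$ is the supremum norm plus the Lipschitz constant. For an increasing function $\tilde g:\mathbb N\to\mathbb R$ let $E_n=\{x:\operatorname{dist}(x,f^jx)\le n^{-1/d}\text{ for some integer }j\in[1,\tilde g(n)]\}$. (H2b), with $\gamma>1$, $\alpha>0$: for some increasing $\tilde g$ with $\tilde g(n)\sim(\log n)^\gamma$ and some $C>0$, $\nu(E_n)\le C/(\log n)^\alpha$ for all $n\ge2$. (H2c), with $\gamma>1$, $\alpha\in(0,1)$: for some increasing $\tilde g$ with $\tilde g(n)\sim(\log n)^\gamma$ and some $C>0$, $\nu(E_n)\le C\exp\{-(\log n)^\alpha\}$ for all $n\ge2$. Theorem. For every $\delta>0$ there is a constant $C_2>0$, depending only on $\delta$, such that the following holds for every system as above. Suppose that (H1) holds with $\Theta(n)=O(\theta_0^{n^\beta})$ for some $\theta_0\in(0,1)$ and $\beta\in(0,1]$, and let $\gamma>1$ with $\gamma\beta>1$.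 1. If (H2b) holds with $\gamma$ and $\alpha$, then for $\nu$-a.e. $\tilde x$, every $\kappa>C_2/\beta$ and every $R$, there is $C_1>0$ (depending on $\tilde x$, $\kappa$, $R$) such that for all $n\ge2$ and all $|u|\le R$ $$\bigl|\nu\{M_n\le u_n\}-G_{\sqrt n}(u)\bigr|\le\frac{C_1}{(\log n)^{\alpha-\kappa}}.$$ 2. If (H2c) holds with $\gamma$ and $\alpha$, then there is $\tilde\alpha>0$ such that for $\nu$-a.e. $\tilde x$ and every $R$ there is $C_1>0$ (depending on $\tilde x$, $R$) such that for all $n\ge2$ and all $|u|\le R$ $$\bigl|\nu\{M_n\le u_n\}-G_{\sqrt n}(u)\bigr|\le C_1\exp\{-(\log n)^{\tilde\alpha}\}.$$ Furthermore, in both cases, for $\nu$-a.e. $\tilde x$ there is $C(\tilde x)>0$ such that for every $u\in\mathbb R$ $$\lim_{n\to\infty}\nu\{M_n\le u_n\}=\exp\{-C(\tilde x)e^{-u}\}.$$ -/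

import Mathlib

open MeasureTheory Filter Topology Asymptotics
open scoped ENNReal NNReal Manifold ContDiff Bundle

noncomputable section

/-- The measure `ν` has a density of class `L^{1+δ}` with respect to `m`. -/
def HasLpDensity {X : Type*} [MeasurableSpace X] (m ν : Measure X) (δ : ℝ) : Prop :=
  ∃ ρ : X → ℝ, (∀ x, 0 ≤ ρ x) ∧ Measurable ρ ∧ MemLp ρ (ENNReal.ofReal (1 + δ)) m ∧
    ν = m.withDensity (fun x => ENNReal.ofReal (ρ x))

/-- Positive Lyapunov exponents in every direction: at `ν`-almost every `x` all iterates of `f` are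
differentiable, and `lim (1/n) log ‖Df^n(x) v‖` exists and is at least `l₀ > 0` for every nonzero
tangent vector `v` at `x` (norms are those of the Riemannian metric). -/
def IsNonUniformlyExpanding {d : ℕ} {H : Type*} [TopologicalSpace H]
    (I : ModelWithCorners ℝ (EuclideanSpace ℝ (Fin d)) H)
    {X : Type*} [EMetricSpace X] [ChartedSpace H X] [IsManifold I ∞ X]
    [Bundle.RiemannianBundle (fun x : X => TangentSpace I x)] [MeasurableSpace X]
    (f : X → X) (ν : Measure X) : Prop :=
  ∃ l₀ : ℝ, 0 < l₀ ∧ ∀ᵐ x ∂ν, (∀ n : ℕ, MDifferentiableAt I I f^[n] x) ∧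
    ∀ v : TangentSpace I x, v ≠ 0 → ∃ L : ℝ, l₀ ≤ L ∧
      Tendsto (fun n : ℕ => 1 / (n : ℝ) * Real.log ‖mfderiv I I f^[n] x v‖) atTop (𝓝 L)

/-- Decay of correlations with rate `Θ`, for bounded Lipschitz functions against `L^∞` functions.
The Lipschitz norm of `φ₁` is the supremum norm plus the Lipschitz constant; the bound is required
for every upper bound `B` of `|φ₁|` and every Lipschitz constant `K` of `φ₁`, which is the same as
requiring it for the least ones. -/
def DecayOfCorrelations {X : Type*} [EMetricSpace X] [MeasurableSpace X]
    (f : X → X) (ν : Measure X) (Θ : ℕ → ℝ) : Prop :=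
  Antitone Θ ∧ Tendsto Θ atTop (𝓝 0) ∧
    ∀ (φ₁ φ₂ : X → ℝ) (B K : ℝ≥0), (∀ x, |φ₁ x| ≤ B) → LipschitzWith K φ₁ → MemLp φ₂ ∞ ν →
      ∀ j : ℕ, |∫ x, φ₁ x * φ₂ (f^[j] x) ∂ν - (∫ x, φ₁ x ∂ν) * ∫ x, φ₂ x ∂ν| ≤
        Θ j * ((B : ℝ) + K) * (eLpNorm φ₂ ∞ ν).toReal

/-- The recurrence set `E_n`: the points `x` with `dist (x, f^j x) ≤ n^{-1/d}` for some integer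
`j ∈ [1, g n]`. -/
def recurrenceSet {X : Type*} [EMetricSpace X] (d : ℕ) (f : X → X) (g : ℕ → ℝ) (n : ℕ) : Set X :=
  {x | ∃ j : ℕ, 1 ≤ j ∧ (j : ℝ) ≤ g n ∧
    edist x (f^[j] x) ≤ ENNReal.ofReal ((n : ℝ) ^ (-(1 / (d : ℝ))))}

/-- Recurrence on a logarithmic time scale: for some increasing `g n ∼ (log n)^γ`, the recurrence
sets satisfy `ν (E_n) ≤ C * r n` for all `n ≥ 2`. -/
def LogScaleRecurrence {X : Type*} [EMetricSpace X] [MeasurableSpace X] (d : ℕ)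
    (f : X → X) (ν : Measure X) (γ : ℝ) (r : ℕ → ℝ) : Prop :=
  ∃ g : ℕ → ℝ, Monotone g ∧ g ~[atTop] (fun n : ℕ => Real.log n ^ γ) ∧
    ∃ C : ℝ, 0 < C ∧ ∀ n : ℕ, 2 ≤ n → ν.real (recurrenceSet d f g n) ≤ C * r n

/-- Weak quantitative recurrence rates: `ν (E_n) ≤ C / (log n)^α`. -/
def WeakRecurrence {X : Type*} [EMetricSpace X] [MeasurableSpace X] (d : ℕ)
    (f : X → X) (ν : Measure X) (γ α : ℝ) : Prop :=
  LogScaleRecurrence d f ν γ (fun n => 1 / Real.log n ^ α)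

/-- Intermediate quantitative recurrence rates: `ν (E_n) ≤ C exp (-(log n)^α)`. -/
def IntermediateRecurrence {X : Type*} [EMetricSpace X] [MeasurableSpace X] (d : ℕ)
    (f : X → X) (ν : Measure X) (γ α : ℝ) : Prop :=
  LogScaleRecurrence d f ν γ (fun n => Real.exp (-(Real.log n ^ α)))

/-- The observable `x ↦ -log dist (x, x₀)`, with value `+∞` at `x₀`. -/
def logDistObservable {X : Type*} [EMetricSpace X] (x₀ x : X) : EReal :=
  -ENNReal.log (edist x x₀)

/-- `M_n = max (φ, φ ∘ f, …, φ ∘ f^{n-1})`. -/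
def maxProcess {X : Type*} (f : X → X) (φ : X → EReal) (n : ℕ) (x : X) : EReal :=
  (Finset.range n).sup (fun i => φ (f^[i] x))

/-- The threshold `u_n = u / d + d⁻¹ log n`. -/
def threshold (d n : ℕ) (u : ℝ) : ℝ := u / d + (d : ℝ)⁻¹ * Real.log n

/-- The probability `ν {M_n ≤ u_n}`, for the observable `-log dist (·, x₀)`. -/
def maxProb {X : Type*} [EMetricSpace X] [MeasurableSpace X] (d : ℕ)
    (f : X → X) (ν : Measure X) (x₀ : X) (n : ℕ) (u : ℝ) : ℝ :=
  ν.real {x | maxProcess f (logDistObservable x₀) n x ≤ (threshold d n u : EReal)}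

/-- `τ_n(u) = n ν {φ ≥ u_n}`, for the observable `φ = -log dist (·, x₀)`. -/
def tau {X : Type*} [EMetricSpace X] [MeasurableSpace X] (d : ℕ)
    (ν : Measure X) (x₀ : X) (n : ℕ) (u : ℝ) : ℝ :=
  n * ν.real {x | (threshold d n u : EReal) ≤ logDistObservable x₀ x}

/-- `G_{√n}(u) = (1 - τ_n(u) / √n)^{√n}`. -/
def sqrtApprox {X : Type*} [EMetricSpace X] [MeasurableSpace X] (d : ℕ)
    (ν : Measure X) (x₀ : X) (n : ℕ) (u : ℝ) : ℝ :=
  (1 - tau d ν x₀ n u / √(n : ℝ)) ^ √(n : ℝ)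

/-- At `x₀`, the laws of the normalized maxima converge to a Gumbel law
`u ↦ exp (-C e^{-u})` with `C > 0`. -/
def GumbelLimit {X : Type*} [EMetricSpace X] [MeasurableSpace X] (d : ℕ)
    (f : X → X) (ν : Measure X) (x₀ : X) : Prop :=
  ∃ C : ℝ, 0 < C ∧ ∀ u : ℝ,
    Tendsto (fun n : ℕ => maxProb d f ν x₀ n u) atTop (𝓝 (Real.exp (-(C * Real.exp (-u)))))

end

/-! Fix a typical point `x₀` and put `r = exp(-u_n)`, so that `r ^ d = e^{-u} / n`. The event `M_n ≤
u_n` says that the first `n` points of the orbit avoid the open ball `V` of radius `r` around `x₀`.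
Let `A_l` be the event of avoiding `V` for `l` steps and `p_l` its probability. Invariance gives
`p_{l+1} = p_l - ν(V ∩ f⁻¹ A_l)`, and if the last term were `ν(V) p_l`, then `p_n` would be `(1 - ν
V) ^ n`. This power is close to `exp(-τ_n)`, and so is `G_{√n}`.

Replacing `ν(V ∩ f⁻¹ A_l)` by `ν(V) p_l` costs three errors (`abs_avoidSet_sub_pow_le`): points of
`V` returning to `V` within `t` steps, the correlation between `V` and an event `t + 1` steps later,
and `t ν(V)²` for the neglected times. They add up over `n` steps, so each must be small compared
with `1 / n`.

Correlations: the hypothesis concerns Lipschitz functions, so the indicator of the ball is replaced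
by a cutoff, at the price of the measure of an annulus of width `s`. In a length space with regular
balls, annuli of width `r / 4 ^ j` have geometrically small volume
(`IsLengthSpace.exists_measure_annulus_le`), hence geometrically small `ν`-measure by Hölder's
inequality. A polynomially small `s` thus makes the annulus `O(n⁻²)`, and a gap of order `(log n) ^
γ` with `γ β > 1` makes `Θ` beat the Lipschitz constant `1 / s`.

Short returns: a point of `V` that returns within `g N` steps lies in the recurrence set `E_N` once
`2 r ≤ N ^ (-1/d)`. What is needed is that `E_N` fills only a small proportion of the ball around
`x₀`. The weak type maximal inequality and Borel–Cantelli, applied along `N_k = 2 ^ (k + 1) ^ a`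
with weights `(k + 1) ^ 2 ν(E_{N_k})`, give this almost everywhere
(`HasBilipschitzCharts.ae_eventually_measure_inter_le`). The weight loses a factor `(log n) ^ (2 /
a)`, an arbitrarily small power of the logarithm when `a` is large. Since `β ≤ 1` forces `κ > C₂ / β
≥ C₂`, the value `C₂ = 1` leaves room for it.

Finally `τ_n(u)` tends to `C e^{-u}`, where `C` is the limit of `ν(B_r(x₀)) / r ^ d`. That limit
exists almost everywhere by Lebesgue differentiation in charts whose bilipschitz constants are
arbitrarily close to one. -/

section RiemannianGeometry

/-! ### Length space property and almost isometric charts. -/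

open Manifold Set

variable {E : Type*} [NormedAddCommGroup E] [NormedSpace ℝ E]
  {H : Type*} [TopologicalSpace H] {I : ModelWithCorners ℝ E H}
  {M : Type*} [EMetricSpace M] [ChartedSpace H M]
  [Bundle.RiemannianBundle (fun x : M => TangentSpace I x)]

/-- A Riemannian manifold is a length space: a point at distance `s` from `y` can be found on an
almost minimizing path from `x` to `y`. -/
theorem exists_edist_eq_and_add_le [IsRiemannianManifold I M] {x y : M} {s ε : ℝ≥0∞}
    (hs : s ≤ edist x y) (hfin : edist x y ≠ ⊤) (hε : ε ≠ 0) :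
    ∃ z, edist z y = s ∧ edist x z + s ≤ edist x y + ε := by
  have hlt : riemannianEDist I x y < edist x y + ε := by
    rw [← IsRiemannianManifold.out (I := I)]
    exact ENNReal.lt_add_right hfin hε
  obtain ⟨γ, h0, h1, hγ, hlen⟩ := exists_lt_of_riemannianEDist_lt hlt
  -- Along the path the distance to `y` falls continuously from `edist x y` to `0`, so it takes the
  -- value `s`.
  have hc : ContinuousOn (fun t => edist (γ t) y) (Icc 0 1) :=
    (continuous_id.edist continuous_const).comp_continuousOn hγ.continuousOn
  obtain ⟨t, ht, hts⟩ : s ∈ (fun t => edist (γ t) y) '' Icc 0 1 := by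
    apply intermediate_value_Icc' zero_le_one hc
    simp [h0, h1, hs]
  refine ⟨γ t, hts, ?_⟩
  have hadd := pathELength_add (I := I) (γ := γ) ht.1 ht.2
  have e1 : edist x (γ t) ≤ pathELength I γ 0 t := by
    rw [IsRiemannianManifold.out (I := I)]
    exact riemannianEDist_le_pathELength (hγ.mono (Icc_subset_Icc_right ht.2)) h0 rfl ht.1
  have e2 : s ≤ pathELength I γ t 1 := by
    rw [← hts]
    change edist (γ t) y ≤ _
    rw [IsRiemannianManifold.out (I := I)]
    exact riemannianEDist_le_pathELength (hγ.mono (Icc_subset_Icc_left ht.1)) rfl h1 ht.2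
  calc edist x (γ t) + s ≤ pathELength I γ 0 t + pathELength I γ t 1 := add_le_add e1 e2
    _ = pathELength I γ 0 1 := hadd
    _ ≤ _ := hlen.le

variable [IsManifold I 1 M]

variable (I) in
/-- The chart at `x`, with values in the tangent space at `x` with its Riemannian norm. -/
noncomputable def tangentChart (x : M) (y : M) : TangentSpace I x :=
  (trivializationAt E (fun x : M => TangentSpace I x) x).symmL ℝ x (extChartAt I x y)

/-- A path that stays where the metric is almost constant is not much shorter than the distance of
its endpoints, read in the chart. -/
theorem edist_tangentChart_le_pathELength (x : M) {r : ℝ≥0} {γ : ℝ → M}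
    (hγ : ContMDiffOn 𝓘(ℝ, ℝ) I 1 γ (Icc 0 1))
    (hsrc : ∀ t ∈ Icc (0 : ℝ) 1, γ t ∈ (chartAt H x).source)
    (hr : ∀ t ∈ Icc (0 : ℝ) 1, ∀ w : TangentSpace I (γ t),
      ‖(trivializationAt E (TangentSpace I) x).symmL ℝ x
        ((trivializationAt E (TangentSpace I) x).continuousLinearMapAt ℝ (γ t) w)‖ₑ ≤ r * ‖w‖ₑ) :
    edist (tangentChart I x (γ 0)) (tangentChart I x (γ 1)) ≤ r * pathELength I γ 0 1 := by
  set A := (trivializationAt E (TangentSpace I) x).symmL ℝ x with hA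
  set γ' : ℝ → E := extChartAt I x ∘ γ with hγ'
  have hC : ContMDiffOn 𝓘(ℝ, ℝ) 𝓘(ℝ, E) 1 γ' (Icc 0 1) :=
    contMDiffOn_extChartAt.comp (I' := I) (t := (chartAt H x).source) hγ hsrc
  have hC' : ContDiffOn ℝ 1 γ' (Icc 0 1) := contMDiffOn_iff_contDiffOn.1 hC
  have hC'' : ContDiffOn ℝ 1 (fun t => A (γ' t)) (Icc 0 1) := A.contDiff.comp_contDiffOn hC'
  rw [edist_comm, edist_eq_enorm_sub]
  refine (enorm_sub_le_lintegral_derivWithin_Icc_of_contDiffOn_Icc hC'' zero_le_one).trans ?_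
  rw [pathELength_eq_lintegral_mfderivWithin_Icc, ← lintegral_const_mul' _ _ ENNReal.coe_ne_top]
  apply setLIntegral_mono' measurableSet_Icc (fun t ht => ?_)
  have hu : UniqueDiffWithinAt ℝ (Icc (0 : ℝ) 1) t := uniqueDiffOn_Icc zero_lt_one _ ht
  have e1 : derivWithin (fun t => A (γ' t)) (Icc 0 1) t = A (derivWithin γ' (Icc 0 1) t) :=
    ((A.hasFDerivAt.comp_hasDerivWithinAt t
      ((hC'.differentiableOn one_ne_zero) t ht).hasDerivWithinAt)).derivWithin hu
  have e2 : derivWithin γ' (Icc 0 1) t = mfderiv I 𝓘(ℝ, E) (extChartAt I x) (γ t)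
      (mfderivWithin 𝓘(ℝ, ℝ) I γ (Icc 0 1) t 1) := by
    have : mfderivWithin 𝓘(ℝ, ℝ) 𝓘(ℝ, E) γ' (Icc 0 1) t =
        (mfderiv I 𝓘(ℝ, E) (extChartAt I x) (γ t)) ∘L (mfderivWithin 𝓘(ℝ, ℝ) I γ (Icc 0 1) t) := by
      apply mfderiv_comp_mfderivWithin
      · exact mdifferentiableAt_extChartAt (hsrc t ht)
      · exact hγ.mdifferentiableOn one_ne_zero _ ht
      · rw [uniqueMDiffWithinAt_iff_uniqueDiffWithinAt]
        exact hu
    rw [← fderivWithin_derivWithin, ← mfderivWithin_eq_fderivWithin]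
    exact congr($this 1)
  -- The derivative of the chart is the trivialization over `x`, so `hr` compares the integrands
  -- pointwise.
  rw [e1, e2, ← TangentBundle.continuousLinearMapAt_trivializationAt (hsrc t ht)]
  exact hr t ht _


variable [IsContinuousRiemannianBundle E (fun x : M => TangentSpace I x)]

theorem eventually_enorm_symmL_le (x : M) {r : ℝ≥0} (hr : 1 < r) :
    ∀ᶠ y in 𝓝 x, ∀ v : E, ‖(trivializationAt E (TangentSpace I) x).symmL ℝ y v‖ₑ ≤
      r * ‖(trivializationAt E (TangentSpace I) x).symmL ℝ x v‖ₑ := by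
  filter_upwards [eventually_norm_symmL_trivializationAt_comp_self_lt E
    (fun x : M => TangentSpace I x) x (r := r) (by exact_mod_cast hr)] with y hy v
  have hx : x ∈ (trivializationAt E (TangentSpace I) x).baseSet :=
    FiberBundle.mem_baseSet_trivializationAt' x
  have h := ContinuousLinearMap.le_of_opNorm_le _ hy.le
    ((trivializationAt E (TangentSpace I) x).symmL ℝ x v)
  rw [ContinuousLinearMap.comp_apply,
    Bundle.Trivialization.continuousLinearMapAt_symmL _ hx] at h
  rw [← enorm_norm, ← enorm_norm ((trivializationAt E (TangentSpace I) x).symmL ℝ x v),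
    Real.enorm_of_nonneg (norm_nonneg _), Real.enorm_of_nonneg (norm_nonneg _),
    ← ENNReal.ofReal_coe_nnreal, ← ENNReal.ofReal_mul r.coe_nonneg]
  exact ENNReal.ofReal_le_ofReal h

theorem eventually_enorm_symmL_continuousLinearMapAt_le (x : M) {r : ℝ≥0} (hr : 1 < r) :
    ∀ᶠ y in 𝓝 x, ∀ w : TangentSpace I y, ‖(trivializationAt E (TangentSpace I) x).symmL ℝ x
      ((trivializationAt E (TangentSpace I) x).continuousLinearMapAt ℝ y w)‖ₑ ≤ r * ‖w‖ₑ := by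
  filter_upwards [eventually_norm_symmL_trivializationAt_self_comp_lt E
    (fun x : M => TangentSpace I x) x (r := r) (by exact_mod_cast hr)] with y hy w
  have h := ContinuousLinearMap.le_of_opNorm_le _ hy.le w
  rw [ContinuousLinearMap.comp_apply] at h
  rw [← enorm_norm, ← enorm_norm w,
    Real.enorm_of_nonneg (norm_nonneg _), Real.enorm_of_nonneg (norm_nonneg _),
    ← ENNReal.ofReal_coe_nnreal, ← ENNReal.ofReal_mul r.coe_nonneg]
  exact ENNReal.ofReal_le_ofReal h

variable [IsRiemannianManifold I M]

/-- An almost shortest path between two points within `ε` of `x` has length below `2 ε`, so it stays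
within `3 ε` of `x`, where the metric is almost the one at `x`. Reading that path in the chart
bounds the distance of the images. -/
theorem exists_nhds_edist_tangentChart_le (x : M) {r : ℝ≥0} (hr : 1 < r) :
    ∃ W ∈ 𝓝 x, ∀ y ∈ W, ∀ z ∈ W,
      edist (tangentChart I x y) (tangentChart I x z) ≤ r * edist y z := by
  obtain ⟨ρ, hρ, hball⟩ := EMetric.mem_nhds_iff.1
    (inter_mem (chart_source_mem_nhds H x)
      (eventually_enorm_symmL_continuousLinearMapAt_le (I := I) x hr))
  obtain ⟨ε, hε, hερ⟩ : ∃ ε : ℝ≥0∞, 0 < ε ∧ 3 * ε ≤ ρ :=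
    ⟨ρ / 3, ENNReal.div_pos hρ.ne' (by simp), by
      rw [ENNReal.mul_div_cancel (by simp) (by simp)]⟩
  refine ⟨Metric.eball x ε, Metric.eball_mem_nhds x hε, fun y hy z hz => ?_⟩
  have hr0 : (r : ℝ≥0∞) ≠ 0 := by
    have : r ≠ 0 := (zero_lt_one.trans hr).ne'
    exact_mod_cast this
  have hyz : edist y z < 2 * ε := by
    calc edist y z ≤ edist y x + edist z x := edist_triangle_right y z x
      _ < ε + ε := ENNReal.add_lt_add hy hz
      _ = 2 * ε := (two_mul ε).symm
  rw [mul_comm, ← ENNReal.div_le_iff hr0 ENNReal.coe_ne_top]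
  refine le_of_forall_gt fun ℓ hℓ => ?_
  have hlt : riemannianEDist I y z < min ℓ (2 * ε) := by
    rw [← IsRiemannianManifold.out (I := I)]
    exact lt_min hℓ hyz
  obtain ⟨γ, h0, h1, hγ, hlen⟩ := exists_lt_of_riemannianEDist_lt hlt
  have hin : ∀ t ∈ Icc (0 : ℝ) 1, γ t ∈ Metric.eball x ρ := by
    intro t ht
    have : edist (γ t) y < 2 * ε := by
      rw [edist_comm, IsRiemannianManifold.out (I := I)]
      calc riemannianEDist I y (γ t) ≤ pathELength I γ 0 t :=
            riemannianEDist_le_pathELength (hγ.mono (Icc_subset_Icc_right ht.2)) h0 rfl ht.1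
        _ ≤ pathELength I γ 0 1 := pathELength_mono le_rfl ht.2
        _ < 2 * ε := hlen.trans_le (min_le_right _ _)
    calc edist (γ t) x ≤ edist (γ t) y + edist y x := edist_triangle _ _ _
      _ < 2 * ε + ε := ENNReal.add_lt_add this hy
      _ = 3 * ε := by ring
      _ ≤ ρ := hερ
  have key := edist_tangentChart_le_pathELength (I := I) x (r := r) hγ
    (fun t ht => (hball (hin t ht)).1) (fun t ht => (hball (hin t ht)).2)
  rw [h0, h1] at key
  refine lt_of_le_of_lt ?_ (hlen.trans_le (min_le_left _ _))
  rwa [ENNReal.div_le_iff hr0 ENNReal.coe_ne_top, mul_comm]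

/-- The straight segment between the coordinates of two points stays in the model, because `range I`
is convex even at the boundary. Its pullback is a path of length at most `r` times the norm, at `x`,
of the coordinate difference. -/
theorem exists_nhds_edist_le_tangentChart (x : M) {r : ℝ≥0} (hr : 1 < r) :
    ∃ W ∈ 𝓝 x, ∀ y ∈ W, ∀ z ∈ W,
      edist y z ≤ r * edist (tangentChart I x y) (tangentChart I x z) := by
  have hmem : (extChartAt I x).target ∩ {p | ∀ v : E,
      ‖(trivializationAt E (TangentSpace I) x).symmL ℝ ((extChartAt I x).symm p) v‖ₑ ≤
      r * ‖(trivializationAt E (TangentSpace I) x).symmL ℝ x v‖ₑ} ∈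
      𝓝[range I] (extChartAt I x x) := by
    refine inter_mem (extChartAt_target_mem_nhdsWithin x) (nhdsWithin_le_nhds ?_)
    have h : ContinuousAt (extChartAt I x).symm (extChartAt I x x) :=
      continuousAt_extChartAt_symm _
    have h2 := eventually_enorm_symmL_le (I := I) x hr
    have h3 : (extChartAt I x).symm (extChartAt I x x) = x := by simp
    rw [ContinuousAt, h3] at h
    exact h.eventually h2
  obtain ⟨ρ, hρ, hball⟩ := Metric.mem_nhdsWithin_iff.1 hmem
  have hW : (extChartAt I x) ⁻¹' (Metric.ball (extChartAt I x x) ρ ∩ range I) ∈ 𝓝 x := by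
    apply extChartAt_preimage_mem_nhds_of_mem_nhdsWithin (by simp)
    rw [inter_comm]
    exact inter_mem_nhdsWithin _ (Metric.ball_mem_nhds _ hρ)
  refine ⟨_, inter_mem hW (chart_source_mem_nhds H x), fun y hy z hz => ?_⟩
  let η := ContinuousAffineMap.lineMap (R := ℝ) (extChartAt I x y) (extChartAt I x z)
  set γ := (extChartAt I x).symm ∘ η with hγdef
  have hη : Icc (0 : ℝ) 1 ⊆ η ⁻¹' ((extChartAt I x).target ∩ {p | ∀ v : E,
      ‖(trivializationAt E (TangentSpace I) x).symmL ℝ ((extChartAt I x).symm p) v‖ₑ ≤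
      r * ‖(trivializationAt E (TangentSpace I) x).symmL ℝ x v‖ₑ}) := by
    simp only [← image_subset_iff, ContinuousAffineMap.coe_lineMap_eq,
      ← segment_eq_image_lineMap, η]
    apply Subset.trans _ hball
    exact ((convex_ball _ _).inter I.convex_range).segment_subset hy.1 hz.1
  have η_smooth : ContMDiffOn 𝓘(ℝ, ℝ) 𝓘(ℝ, E) 1 η (Icc 0 1) := by
    apply ContMDiff.contMDiffOn
    rw [contMDiff_iff_contDiff]
    exact ContinuousAffineMap.contDiff _
  have hle : edist y z ≤ pathELength I γ 0 1 := by
    rw [IsRiemannianManifold.out (I := I)]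
    apply riemannianEDist_le_pathELength _ _ _ zero_le_one
    · exact (contMDiffOn_extChartAt_symm x).comp η_smooth fun t ht => (hη ht).1
    · simp [γ, η, ContinuousAffineMap.coe_lineMap_eq, hy.2]
    · simp [γ, η, ContinuousAffineMap.coe_lineMap_eq, hz.2]
  apply hle.trans
  rw [pathELength_eq_lintegral_mfderivWithin_Icc]
  have hb : ∀ t ∈ Icc (0 : ℝ) 1, ‖mfderivWithin 𝓘(ℝ, ℝ) I γ (Icc 0 1) t 1‖ₑ ≤
      r * edist (tangentChart I x y) (tangentChart I x z) := by
    intro t ht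
    have hsrc : (extChartAt I x).symm (η t) ∈ (chartAt H x).source := by
      rw [← extChartAt_source I]
      exact (extChartAt I x).map_target (hη ht).1
    have hu : UniqueDiffWithinAt ℝ (Icc (0 : ℝ) 1) t := uniqueDiffOn_Icc zero_lt_one _ ht
    have h1 : mfderivWithin 𝓘(ℝ, ℝ) I γ (Icc 0 1) t =
        (mfderivWithin 𝓘(ℝ, E) I (extChartAt I x).symm (range I) (η t)) ∘L
          (mfderivWithin 𝓘(ℝ, ℝ) 𝓘(ℝ, E) η (Icc 0 1) t) := by
      apply mfderivWithin_comp
      · exact mdifferentiableWithinAt_extChartAt_symm (hη ht).1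
      · exact η_smooth.mdifferentiableOn one_ne_zero t ht
      · exact fun s hs => extChartAt_target_subset_range x (hη hs).1
      · rw [uniqueMDiffWithinAt_iff_uniqueDiffWithinAt]
        exact hu
    have h2 : mfderivWithin 𝓘(ℝ, ℝ) 𝓘(ℝ, E) η (Icc 0 1) t 1 =
        (extChartAt I x z - extChartAt I x y : E) := by
      rw [mfderivWithin_eq_fderivWithin,
        fderivWithin_eq_fderiv hu (ContinuousAffineMap.differentiableAt _)]
      have (p q : E) : fderiv ℝ (ContinuousAffineMap.lineMap (R := ℝ) p q) t 1 = q - p := by simp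
      exact this _ _
    have h3 := TangentBundle.symmL_trivializationAt (I := I) hsrc
    rw [(extChartAt I x).right_inv (hη ht).1] at h3
    have h4 : mfderivWithin 𝓘(ℝ, ℝ) I γ (Icc 0 1) t 1 =
        (trivializationAt E (TangentSpace I) x).symmL ℝ ((extChartAt I x).symm (η t))
          (extChartAt I x z - extChartAt I x y) := by
      rw [h3, h1]
      exact congrArg (mfderivWithin 𝓘(ℝ, E) I (extChartAt I x).symm (range I) (η t)) h2
    rw [h4, edist_comm, edist_eq_enorm_sub]
    refine ((hη ht).2 _).trans_eq ?_
    rw [map_sub]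
    rfl
  calc _ ≤ ∫⁻ t in Icc (0 : ℝ) 1, r * edist (tangentChart I x y) (tangentChart I x z) :=
        setLIntegral_mono' measurableSet_Icc hb
    _ = _ := by simp

end RiemannianGeometry

/-! ### Bilipschitz charts covering the manifold up to a null set. -/

section LocalCharts

open Manifold Set

/-- Around every point of a Riemannian manifold there is a coordinate patch which distorts distances
by a factor arbitrarily close to one, and whose image is relatively open in a convex set. -/
theorem exists_bilipschitz_patch {d : ℕ} {H : Type*} [TopologicalSpace H]
    {I : ModelWithCorners ℝ (EuclideanSpace ℝ (Fin d)) H}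
    {M : Type*} [EMetricSpace M] [ChartedSpace H M] [IsManifold I 1 M]
    [Bundle.RiemannianBundle (fun x : M => TangentSpace I x)]
    [IsContinuousRiemannianBundle (EuclideanSpace ℝ (Fin d)) (fun x : M => TangentSpace I x)]
    [IsRiemannianManifold I M] (x : M) {K : ℝ≥0} (hK : 1 < K) :
    ∃ (W : Set M) (ψ : M → EuclideanSpace ℝ (Fin d)) (O D : Set (EuclideanSpace ℝ (Fin d))),
      IsOpen W ∧ x ∈ W ∧ IsOpen O ∧ Convex ℝ D ∧ ψ '' W = O ∩ D ∧
      (∀ y ∈ W, ∀ z ∈ W, edist y z ≤ K * edist (ψ y) (ψ z)) ∧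
      ∀ y ∈ W, ∀ z ∈ W, edist (ψ y) (ψ z) ≤ K * edist y z := by
  obtain ⟨W₁, hW₁, h₁⟩ := exists_nhds_edist_tangentChart_le (I := I) x hK
  obtain ⟨W₂, hW₂, h₂⟩ := exists_nhds_edist_le_tangentChart (I := I) x hK
  obtain ⟨W, hWsub, hWo, hxW⟩ := mem_nhds_iff.1
    (inter_mem (inter_mem hW₁ hW₂) (chart_source_mem_nhds H x))
  have hx : x ∈ (trivializationAt (EuclideanSpace ℝ (Fin d)) (TangentSpace I) x).baseSet :=
    FiberBundle.mem_baseSet_trivializationAt' x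
  let A : EuclideanSpace ℝ (Fin d) ≃L[ℝ] TangentSpace I x :=
    ((trivializationAt (EuclideanSpace ℝ (Fin d)) (TangentSpace I) x).continuousLinearEquivAt ℝ x
      hx).symm
  have hfd : FiniteDimensional ℝ (TangentSpace I x) := A.toLinearEquiv.finiteDimensional
  have hrank : Module.finrank ℝ (TangentSpace I x) = d := by
    rw [← A.toLinearEquiv.finrank_eq, finrank_euclideanSpace_fin]
  let J : TangentSpace I x ≃ₗᵢ[ℝ] EuclideanSpace ℝ (Fin d) :=
    ((stdOrthonormalBasis ℝ (TangentSpace I x)).reindex (finCongr hrank)).repr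
  -- Coordinates in an orthonormal basis of the tangent space at `x` turn its Riemannian norm into
  -- the Euclidean one. The convex set `D` is the image of `range I` under this linear map.
  let Λ : EuclideanSpace ℝ (Fin d) ≃L[ℝ] EuclideanSpace ℝ (Fin d) :=
    A.trans J.toContinuousLinearEquiv
  have hΛ : ∀ y, Λ (extChartAt I x y) = J (tangentChart I x y) := fun y => by
    change J (A _) = J _
    rw [tangentChart, Bundle.Trivialization.symmL_apply]
    · rfl
    · exact hx
  have himg : (extChartAt I x) '' W = I.symm ⁻¹' ((chartAt H x) '' W) ∩ range I := by
    rw [← I.image_eq, image_image]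
    rfl
  have hopen : IsOpen ((chartAt H x) '' W) :=
    (chartAt H x).isOpen_image_of_subset_source hWo fun y hy => (hWsub hy).2
  refine ⟨W, fun y => Λ (extChartAt I x y), Λ '' (I.symm ⁻¹' ((chartAt H x) '' W)),
    Λ '' (range I), hWo, hxW, ?_, ?_, ?_, ?_, ?_⟩
  · exact Λ.toHomeomorph.isOpenMap _ (hopen.preimage I.continuous_symm)
  · exact I.convex_range.linear_image Λ.toLinearEquiv.toLinearMap
  · rw [← image_inter Λ.injective, ← himg, image_image]
  · intro y hy z hz
    simp only [hΛ, J.isometry.edist_eq]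
    exact h₂ y (hWsub hy).1.2 z (hWsub hz).1.2
  · intro y hy z hz
    simp only [hΛ, J.isometry.edist_eq]
    exact h₁ y (hWsub hy).1.1 z (hWsub hz).1.1

/-- `ψ` is a `K`-bilipschitz homeomorphism from the open set `W` to an open subset of `ℝ^d`. -/
structure IsBilipschitzChart {X : Type*} [EMetricSpace X] {d : ℕ} (K : ℝ≥0) (W : Set X)
    (ψ : X → EuclideanSpace ℝ (Fin d)) : Prop where
  isOpen_source : IsOpen W
  isOpen_target : IsOpen (ψ '' W)
  edist_le : ∀ y ∈ W, ∀ z ∈ W, edist y z ≤ K * edist (ψ y) (ψ z)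
  edist_map_le : ∀ y ∈ W, ∀ z ∈ W, edist (ψ y) (ψ z) ≤ K * edist y z

namespace IsBilipschitzChart

variable {X : Type*} [EMetricSpace X] {d : ℕ} {K : ℝ≥0} {W : Set X}
  {ψ : X → EuclideanSpace ℝ (Fin d)}

theorem lipschitzOnWith (h : IsBilipschitzChart K W ψ) : LipschitzOnWith K ψ W :=
  fun y hy z hz => h.edist_map_le y hy z hz

end IsBilipschitzChart

theorem euclideanHausdorffMeasure_image_le {X Y : Type*} [EMetricSpace X] [EMetricSpace Y]
    [MeasurableSpace X] [BorelSpace X] [MeasurableSpace Y] [BorelSpace Y] {K : ℝ≥0} {f : X → Y}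
    {s : Set X} (h : LipschitzOnWith K f s) (d : ℕ) :
    Measure.euclideanHausdorffMeasure d (f '' s) ≤
      (K : ℝ≥0∞) ^ d * Measure.euclideanHausdorffMeasure d s := by
  have := h.hausdorffMeasure_image_le (d := d) (Nat.cast_nonneg d)
  rw [Measure.euclideanHausdorffMeasure_def, Measure.euclideanHausdorffMeasure_def,
    Measure.smul_apply, Measure.smul_apply, ENNReal.smul_def, ENNReal.smul_def, smul_eq_mul,
    smul_eq_mul, ← ENNReal.rpow_natCast, mul_left_comm]
  gcongr

/-- If `ψ` is antilipschitz on `s`, the Hausdorff measure of `s` is controlled by the Lebesgue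
measure of `ψ '' s`. -/
theorem euclideanHausdorffMeasure_le_volume_image {X : Type*} [EMetricSpace X]
    [MeasurableSpace X] [BorelSpace X] {d : ℕ} {K : ℝ≥0} {s : Set X}
    {ψ : X → EuclideanSpace ℝ (Fin d)}
    (h : ∀ y ∈ s, ∀ z ∈ s, edist y z ≤ K * edist (ψ y) (ψ z)) :
    Measure.euclideanHausdorffMeasure d s ≤ (K : ℝ≥0∞) ^ d * volume (ψ '' s) := by
  rcases s.eq_empty_or_nonempty with rfl | ⟨x₀, hx₀⟩
  · simp
  have : Nonempty X := ⟨x₀⟩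
  have hinj : InjOn ψ s := by
    intro y hy z hz hyz
    have := h y hy z hz
    rw [hyz, edist_self, mul_zero] at this
    exact edist_le_zero.1 this
  have hinv : ∀ y ∈ s, Function.invFunOn ψ s (ψ y) = y := fun y hy => hinj.leftInvOn_invFunOn hy
  have hL : LipschitzOnWith K (Function.invFunOn ψ s) (ψ '' s) := by
    rintro _ ⟨y, hy, rfl⟩ _ ⟨z, hz, rfl⟩
    rw [hinv y hy, hinv z hz]
    exact h y hy z hz
  have := euclideanHausdorffMeasure_image_le hL d
  rwa [image_image, image_congr hinv, image_id',
    EuclideanSpace.euclideanHausdorffMeasure_eq_volume] at this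

/-- Up to a null set, a second countable Riemannian manifold is covered by countably many charts
which distort distances by a factor arbitrarily close to one. -/
theorem exists_countable_bilipschitz_charts {d : ℕ} {H : Type*} [TopologicalSpace H]
    (I : ModelWithCorners ℝ (EuclideanSpace ℝ (Fin d)) H)
    {M : Type*} [EMetricSpace M] [SecondCountableTopology M] [ChartedSpace H M] [IsManifold I 1 M]
    [Bundle.RiemannianBundle (fun x : M => TangentSpace I x)]
    [IsContinuousRiemannianBundle (EuclideanSpace ℝ (Fin d)) (fun x : M => TangentSpace I x)]
    [IsRiemannianManifold I M] [MeasurableSpace M] [BorelSpace M] {K : ℝ≥0} (hK : 1 < K) :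
    ∃ (ι : Type) (_ : Countable ι) (W : ι → Set M) (ψ : ι → M → EuclideanSpace ℝ (Fin d)),
      (∀ i, IsBilipschitzChart K (W i) (ψ i)) ∧
      Measure.euclideanHausdorffMeasure d (⋃ i, W i)ᶜ = 0 := by
  choose W ψ O D hWo hxW hO hD himg hle hge using
    fun x : M => exists_bilipschitz_patch (I := I) x hK
  obtain ⟨T, hT, hTU⟩ := TopologicalSpace.isOpen_iUnion_countable W hWo
  have hcov : ⋃ i ∈ T, W i = univ := by
    rw [hTU]
    exact eq_univ_of_forall fun x => mem_iUnion.2 ⟨x, hxW x⟩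
  have hcont : ∀ x, ContinuousOn (ψ x) (W x) := fun x =>
    LipschitzOnWith.continuousOn (K := K) fun y hy z hz => hge x y hy z hz
  have : Countable T := hT
  -- The countable set `T` of base points is transported into `ℕ` so that the index type lies in
  -- `Type`, whatever the universe of `M`.
  obtain ⟨n, hn⟩ : ∃ n : T → ℕ, Function.Injective n := Countable.exists_injective_nat T
  -- Keeping only the interior of the convex set makes the image open. What is discarded maps into
  -- the frontier of a convex set, which is Lebesgue null.
  let W' : T → Set M := fun i => W i ∩ ψ i ⁻¹' (interior (D i))
  have hW'img : ∀ i : T, ψ i '' (W' i) = O i ∩ interior (D i) := by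
    intro i
    rw [image_inter_preimage, himg, inter_assoc, inter_eq_right.2 interior_subset]
  have hchart : ∀ i : T, IsBilipschitzChart K (W' i) (ψ i) := by
    intro i
    refine ⟨(hcont i).isOpen_inter_preimage (hWo i) isOpen_interior, ?_, ?_, ?_⟩
    · rw [hW'img]
      exact (hO i).inter isOpen_interior
    · exact fun y hy z hz => hle i y hy.1 z hz.1
    · exact fun y hy z hz => hge i y hy.1 z hz.1
  refine ⟨range n, inferInstance, fun k => W' (Equiv.ofInjective n hn |>.symm k),
    fun k => ψ (Equiv.ofInjective n hn |>.symm k), fun k => hchart _, ?_⟩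
  have hU : ⋃ k, W' (Equiv.ofInjective n hn |>.symm k) = ⋃ i, W' i :=
    (Equiv.ofInjective n hn).symm.surjective.iUnion_comp W'
  rw [hU]
  have hsub : (⋃ i, W' i)ᶜ ⊆ ⋃ i : T, W i \ W' i := by
    intro y hy
    have : y ∈ ⋃ i ∈ T, W i := hcov ▸ mem_univ y
    obtain ⟨i, hi, hyi⟩ := mem_iUnion₂.1 this
    exact mem_iUnion.2 ⟨⟨i, hi⟩, hyi, fun h => hy (mem_iUnion.2 ⟨⟨i, hi⟩, h⟩)⟩
  refine measure_mono_null hsub (measure_iUnion_null fun i => ?_)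
  have hb := euclideanHausdorffMeasure_le_volume_image (s := W i \ W' i)
    (fun y hy z hz => hle i y hy.1 z hz.1)
  have hz : volume (ψ i '' (W i \ W' i)) = 0 := by
    refine measure_mono_null ?_ ((hD i).addHaar_frontier volume)
    rintro _ ⟨y, hy, rfl⟩
    have : ψ i y ∈ O i ∩ D i := himg i ▸ mem_image_of_mem _ hy.1
    exact ⟨subset_closure this.2, fun h => hy.2 ⟨hy.1, h⟩⟩
  rw [hz, mul_zero] at hb
  exact le_antisymm hb bot_le

end LocalCharts

/-! ### Lebesgue differentiation of `ν` along Riemannian balls. -/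

section Density

open Set Metric

/-- The constant `A` may change with `ε`, so no limit is known in advance. The bounds still confine
`log F` to intervals of arbitrarily small length, so `log F` is Cauchy along `l`. -/
theorem exists_tendsto_of_forall_exp_bounds {l : Filter ℝ} [l.NeBot] {F : ℝ → ℝ}
    (h : ∀ ε : ℝ, 0 < ε → ∃ A : ℝ, 0 < A ∧
      ∀ᶠ r in l, A * Real.exp (-ε) ≤ F r ∧ F r ≤ A * Real.exp ε) :
    ∃ C : ℝ, 0 < C ∧ Tendsto F l (𝓝 C) := by
  have hpos : ∀ᶠ r in l, 0 < F r := by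
    obtain ⟨A, hA, h1⟩ := h 1 one_pos
    filter_upwards [h1] with r hr
    exact (by positivity : 0 < A * Real.exp (-1)).trans_le hr.1
  have hc : Cauchy (map (fun r => Real.log (F r)) l) := by
    refine Metric.cauchy_iff.2 ⟨inferInstance, fun ε hε => ?_⟩
    obtain ⟨A, hA, h1⟩ := h (ε / 3) (by positivity)
    refine ⟨Icc (Real.log A - ε / 3) (Real.log A + ε / 3), ?_, ?_⟩
    · rw [mem_map]
      filter_upwards [h1, hpos] with r hr hr0
      have e1 := Real.log_le_log (by positivity) hr.1
      have e2 := Real.log_le_log hr0 hr.2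
      rw [Real.log_mul hA.ne' (Real.exp_pos _).ne', Real.log_exp] at e1 e2
      exact ⟨by linarith, e2⟩
    · intro a ha b hb
      rw [Real.dist_eq, abs_lt]
      constructor <;> linarith [ha.1, ha.2, hb.1, hb.2]
  obtain ⟨c, hc⟩ := CompleteSpace.complete hc
  refine ⟨Real.exp c, Real.exp_pos c, ?_⟩
  have := (Real.continuous_exp.tendsto c).comp (show Tendsto _ l (𝓝 c) from hc)
  refine this.congr' ?_
  filter_upwards [hpos] with r hr
  exact Real.exp_log hr

namespace IsBilipschitzChart

variable {X : Type*} [EMetricSpace X] [MeasurableSpace X] [BorelSpace X] {d : ℕ} {K : ℝ≥0}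
  {W : Set X} {ψ : X → EuclideanSpace ℝ (Fin d)}

theorem aemeasurable (h : IsBilipschitzChart K W ψ) (ν : Measure X) :
    AEMeasurable ψ (ν.restrict W) :=
  h.lipschitzOnWith.continuousOn.aemeasurable h.isOpen_source.measurableSet

theorem measure_inter_preimage_le (h : IsBilipschitzChart K W ψ)
    (S : Set (EuclideanSpace ℝ (Fin d))) :
    Measure.euclideanHausdorffMeasure d (W ∩ ψ ⁻¹' S) ≤ (K : ℝ≥0∞) ^ d * volume S := by
  refine (euclideanHausdorffMeasure_le_volume_image (ψ := ψ)
    (fun y hy z hz => h.edist_le y hy.1 z hz.1)).trans ?_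
  gcongr
  rintro _ ⟨y, hy, rfl⟩
  exact hy.2

theorem ae_of_ae_volume (h : IsBilipschitzChart K W ψ) {ν : Measure X}
    (hν : ν ≪ Measure.euclideanHausdorffMeasure d) {P : EuclideanSpace ℝ (Fin d) → Prop}
    (hP : ∀ᵐ y, P y) : ∀ᵐ x ∂ν, x ∈ W → P (ψ x) := by
  refine hν.ae_le (?_ : ∀ᵐ x ∂(Measure.euclideanHausdorffMeasure d), x ∈ W → P (ψ x))
  rw [ae_iff] at hP ⊢
  have := h.measure_inter_preimage_le {y | ¬ P y}
  rw [hP, mul_zero] at this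
  refine measure_mono_null (fun x hx => ?_) (le_antisymm this bot_le)
  simp only [mem_ofPred_eq, Classical.not_imp] at hx
  exact hx

theorem map_absolutelyContinuous (h : IsBilipschitzChart K W ψ) {ν : Measure X}
    (hν : ν ≪ Measure.euclideanHausdorffMeasure d) : (ν.restrict W).map ψ ≪ volume := by
  refine Measure.AbsolutelyContinuous.mk fun S hS hS0 => ?_
  rw [Measure.map_apply_of_aemeasurable (h.aemeasurable ν) hS,
    Measure.restrict_apply' h.isOpen_source.measurableSet, inter_comm]
  refine hν ?_
  have := h.measure_inter_preimage_le S
  rw [hS0, mul_zero] at this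
  exact le_antisymm this bot_le

omit [MeasurableSpace X] [BorelSpace X] in
theorem exists_closedEBall_subset (h : IsBilipschitzChart K W ψ) {x : X} (hx : x ∈ W) :
    ∃ r₀ : ℝ, 0 < r₀ ∧ closedEBall x (ENNReal.ofReal r₀) ⊆ W := by
  obtain ⟨ε, hε, hsub⟩ := EMetric.mem_nhds_iff.1 (h.isOpen_source.mem_nhds hx)
  obtain ⟨r, hr, hrε⟩ := ENNReal.lt_iff_exists_real_btwn.1 hε
  refine ⟨r, ?_, fun y hy => hsub ((mem_closedEBall.1 hy).trans_lt hrε.2)⟩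
  exact ENNReal.ofReal_pos.1 hrε.1

omit [MeasurableSpace X] [BorelSpace X] in
theorem mapsTo_closedEBall (h : IsBilipschitzChart K W ψ) {x : X} {r : ℝ}
    (hr : 0 ≤ r) (hsub : closedEBall x (ENNReal.ofReal r) ⊆ W) :
    closedEBall x (ENNReal.ofReal r) ⊆ W ∩ ψ ⁻¹' (closedBall (ψ x) (K * r)) := by
  intro y hy
  refine ⟨hsub hy, ?_⟩
  rw [mem_preimage, mem_closedBall, ← ENNReal.ofReal_le_ofReal_iff (by positivity), ← edist_dist,
    ENNReal.ofReal_mul K.coe_nonneg, ENNReal.ofReal_coe_nnreal]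
  refine (h.edist_map_le y (hsub hy) x (hsub (by simp))).trans ?_
  gcongr
  exact hy

omit [MeasurableSpace X] [BorelSpace X] in
theorem inter_preimage_subset (h : IsBilipschitzChart K W ψ) (hK : 0 < K) {x : X} (hx : x ∈ W)
    (r : ℝ) :
    W ∩ ψ ⁻¹' (closedBall (ψ x) (r / K)) ⊆ closedEBall x (ENNReal.ofReal r) := by
  rintro y ⟨hyW, hy⟩
  rw [mem_closedEBall]
  refine (h.edist_le y hyW x hx).trans ?_
  rw [mem_preimage, mem_closedBall] at hy
  have hK' : (0 : ℝ) < K := hK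
  calc (K : ℝ≥0∞) * edist (ψ y) (ψ x) = ENNReal.ofReal (K * dist (ψ y) (ψ x)) := by
        rw [ENNReal.ofReal_mul K.coe_nonneg, ENNReal.ofReal_coe_nnreal, edist_dist]
    _ ≤ ENNReal.ofReal r := ENNReal.ofReal_le_ofReal (by
        rw [le_div_iff₀ hK'] at hy
        linarith)

/-- The image of `ν` under the chart has a positive finite density at almost every point, by
Besicovitch differentiation. A ball around `x` lies between the preimages of the Euclidean balls of
radii `r / K` and `K r`: this costs `K ^ d`, and one more factor `K` absorbs the error in the
differentiation limit. -/
theorem ae_exists_ball_bounds (h : IsBilipschitzChart K W ψ) (hK : 1 < K) {ν : Measure X}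
    [IsFiniteMeasure ν] (hν : ν ≪ Measure.euclideanHausdorffMeasure d) :
    ∀ᵐ x ∂ν, x ∈ W → ∃ A : ℝ, 0 < A ∧ ∀ᶠ r in 𝓝[>] (0 : ℝ),
      A * ((K : ℝ) ^ (d + 1))⁻¹ ≤ ν.real (closedEBall x (ENNReal.ofReal r)) / r ^ d ∧
        ν.real (closedEBall x (ENNReal.ofReal r)) / r ^ d ≤ A * (K : ℝ) ^ (d + 1) := by
  set μ := (ν.restrict W).map ψ with hμ
  have hac : μ ≪ volume := h.map_absolutelyContinuous hν
  have hK0 : (0 : ℝ) < K := zero_lt_one.trans hK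
  have hK1 : (1 : ℝ) < K := hK
  have hae : ∀ᵐ y ∂μ, 0 < μ.rnDeriv volume y ∧ μ.rnDeriv volume y < ⊤ ∧
      Tendsto (fun r => μ (closedBall y r) / volume (closedBall y r)) (𝓝[>] 0)
        (𝓝 (μ.rnDeriv volume y)) := by
    filter_upwards [Measure.rnDeriv_pos hac, hac.ae_le (Measure.rnDeriv_lt_top μ volume),
      hac.ae_le (Besicovitch.ae_tendsto_rnDeriv μ volume)] with y h1 h2 h3
    exact ⟨h1, h2, h3⟩
  have hae' := ae_of_ae_map (h.aemeasurable ν) hae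
  rw [ae_restrict_iff' h.isOpen_source.measurableSet] at hae'
  filter_upwards [hae'] with x hx hxW
  obtain ⟨hpos, hfin, hlim⟩ := hx hxW
  set q := (μ.rnDeriv volume (ψ x)).toReal with hq
  have hq0 : 0 < q := ENNReal.toReal_pos hpos.ne' hfin.ne
  set v₁ := volume.real (ball (0 : EuclideanSpace ℝ (Fin d)) 1) with hv₁
  have hv₁0 : 0 < v₁ := ENNReal.toReal_pos (measure_ball_pos _ _ one_pos).ne' measure_ball_lt_top.ne
  have hball : ∀ r : ℝ, 0 ≤ r → volume.real (closedBall (ψ x) r) = r ^ d * v₁ := by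
    intro r hr
    rw [measureReal_def, Measure.addHaar_closedBall volume _ hr, ENNReal.toReal_mul,
      ENNReal.toReal_ofReal (by positivity), finrank_euclideanSpace_fin]
    rfl
  have hlim' : Tendsto (fun r => μ.real (closedBall (ψ x) r) / (r ^ d * v₁)) (𝓝[>] 0) (𝓝 q) := by
    refine ((ENNReal.tendsto_toReal hfin.ne).comp hlim).congr' ?_
    filter_upwards [self_mem_nhdsWithin] with r hr
    rw [Function.comp_apply, ENNReal.toReal_div, ← hball r (le_of_lt hr)]
    rfl
  have hbd : ∀ᶠ r in 𝓝[>] (0 : ℝ), q * v₁ * (K : ℝ)⁻¹ * r ^ d ≤ μ.real (closedBall (ψ x) r) ∧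
      μ.real (closedBall (ψ x) r) ≤ q * v₁ * K * r ^ d := by
    have hlow : q * (K : ℝ)⁻¹ < q := mul_lt_of_lt_one_right hq0 (inv_lt_one_of_one_lt₀ hK1)
    have hupp : q < q * K := lt_mul_of_one_lt_right hq0 hK1
    filter_upwards [hlim'.eventually_const_le hlow, hlim'.eventually_le_const hupp,
      self_mem_nhdsWithin]
      with r h1 h2 hr
    have hr0 : (0 : ℝ) < r ^ d := pow_pos hr d
    rw [le_div_iff₀ (by positivity)] at h1
    rw [div_le_iff₀ (by positivity)] at h2
    exact ⟨by linarith, by linarith⟩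
  have hμball : ∀ r, μ.real (closedBall (ψ x) r) = ν.real (W ∩ ψ ⁻¹' closedBall (ψ x) r) := by
    intro r
    rw [measureReal_def, hμ, Measure.map_apply_of_aemeasurable (h.aemeasurable ν)
      measurableSet_closedBall, Measure.restrict_apply' h.isOpen_source.measurableSet, inter_comm]
    rfl
  have hscale : ∀ c : ℝ, 0 < c → Tendsto (fun r : ℝ => c * r) (𝓝[>] 0) (𝓝[>] 0) := by
    intro c hc
    refine tendsto_nhdsWithin_of_tendsto_nhds_of_eventually_within _ ?_ ?_
    · have : Tendsto (fun r : ℝ => c * r) (𝓝 0) (𝓝 (c * 0)) :=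
        (continuous_const_mul c).tendsto 0
      rw [mul_zero] at this
      exact this.mono_left nhdsWithin_le_nhds
    · filter_upwards [self_mem_nhdsWithin] with r hr
      exact mul_pos hc hr
  obtain ⟨r₀, hr₀, hr₀W⟩ := h.exists_closedEBall_subset hxW
  refine ⟨q * v₁, by positivity, ?_⟩
  filter_upwards [(hscale K hK0).eventually hbd, (hscale (K : ℝ)⁻¹ (by positivity)).eventually hbd,
    self_mem_nhdsWithin, Ioc_mem_nhdsGT hr₀] with r h1 h2 hr hrr
  have hr0 : (0 : ℝ) < r := hr
  have hsub : closedEBall x (ENNReal.ofReal r) ⊆ W :=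
    (closedEBall_subset_closedEBall (ENNReal.ofReal_le_ofReal hrr.2)).trans hr₀W
  constructor
  · rw [le_div_iff₀ (by positivity)]
    calc q * v₁ * ((K : ℝ) ^ (d + 1))⁻¹ * r ^ d = q * v₁ * (K : ℝ)⁻¹ * ((K : ℝ)⁻¹ * r) ^ d := by
          rw [mul_pow, pow_succ, mul_inv, inv_pow]
          ring
      _ ≤ μ.real (closedBall (ψ x) ((K : ℝ)⁻¹ * r)) := h2.1
      _ ≤ _ := by
          rw [hμball, inv_mul_eq_div]
          exact measureReal_mono (h.inter_preimage_subset (zero_lt_one.trans hK) hxW r)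
  · rw [div_le_iff₀ (by positivity)]
    calc ν.real (closedEBall x (ENNReal.ofReal r)) ≤ μ.real (closedBall (ψ x) (K * r)) := by
          rw [hμball]
          exact measureReal_mono (h.mapsTo_closedEBall hr0.le hsub)
      _ ≤ q * v₁ * K * (K * r) ^ d := h1.2
      _ = _ := by
          rw [mul_pow, pow_succ]
          ring

end IsBilipschitzChart

/-- Up to null sets, the space is covered by countably many bilipschitz charts with constants
arbitrarily close to one. -/
def HasBilipschitzCharts (d : ℕ) (X : Type*) [EMetricSpace X] [MeasurableSpace X] [BorelSpace X] :
    Prop :=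
  ∀ K : ℝ≥0, 1 < K → ∃ (ι : Type) (_ : Countable ι) (W : ι → Set X)
    (ψ : ι → X → EuclideanSpace ℝ (Fin d)),
      (∀ i, IsBilipschitzChart K (W i) (ψ i)) ∧
      Measure.euclideanHausdorffMeasure d (⋃ i, W i)ᶜ = 0

section

variable {X : Type*} [EMetricSpace X] [MeasurableSpace X] [BorelSpace X] {d : ℕ} {ν : Measure X}

theorem HasBilipschitzCharts.ae_of_forall_chart (hX : HasBilipschitzCharts d X)
    (hν : ν ≪ Measure.euclideanHausdorffMeasure d) {K : ℝ≥0} (hK : 1 < K) {P : X → Prop}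
    (hP : ∀ (W : Set X) (ψ : X → EuclideanSpace ℝ (Fin d)), IsBilipschitzChart K W ψ →
      ∀ᵐ x ∂ν, x ∈ W → P x) : ∀ᵐ x ∂ν, P x := by
  obtain ⟨ι, hι, W, ψ, hW, h0⟩ := hX K hK
  have h1 : ∀ᵐ x ∂ν, x ∈ ⋃ i, W i := hν h0
  filter_upwards [h1, ae_all_iff.2 fun i => hP (W i) (ψ i) (hW i)] with x hx hx'
  obtain ⟨i, hi⟩ := mem_iUnion.1 hx
  exact hx' i hi

/-- The Lebesgue density theorem for Riemannian balls. -/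
theorem HasBilipschitzCharts.ae_tendsto_measure_closedEBall_div (hX : HasBilipschitzCharts d X)
    [IsFiniteMeasure ν] (hν : ν ≪ Measure.euclideanHausdorffMeasure d) :
    ∀ᵐ x ∂ν, ∃ C : ℝ, 0 < C ∧
      Tendsto (fun r : ℝ => ν.real (closedEBall x (ENNReal.ofReal r)) / r ^ d) (𝓝[>] 0) (𝓝 C) := by
  let ε : ℕ → ℝ := fun n => 1 / ((n : ℝ) + 1)
  have hε : ∀ n, 0 < ε n := fun n => by positivity
  -- Chosen so that the loss `K ^ (d + 1)` of a chart is exactly `exp (ε n)`; countably many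
  -- constants keep the exceptional set null.
  let K : ℕ → ℝ≥0 := fun n => ⟨Real.exp (ε n / (d + 1)), (Real.exp_pos _).le⟩
  have hK : ∀ n, 1 < K n := fun n => by
    change (1 : ℝ) < Real.exp (ε n / (d + 1))
    exact Real.one_lt_exp_iff.2 (div_pos (hε n) (by positivity))
  have hKpow : ∀ n, (K n : ℝ) ^ (d + 1) = Real.exp (ε n) := fun n => by
    change Real.exp (ε n / (d + 1)) ^ (d + 1) = _
    rw [← Real.exp_nat_mul]
    congr 1
    push_cast
    field_simp
  have hall := ae_all_iff.2 fun n => hX.ae_of_forall_chart hν (hK n)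
    fun W ψ hW => hW.ae_exists_ball_bounds (hK n) hν
  filter_upwards [hall] with x hx
  refine exists_tendsto_of_forall_exp_bounds fun e he => ?_
  obtain ⟨n, hn⟩ := exists_nat_one_div_lt he
  obtain ⟨A, hA, hb⟩ := hx n
  refine ⟨A, hA, ?_⟩
  filter_upwards [hb] with r hr
  rw [hKpow n, ← Real.exp_neg] at hr
  have h1 : Real.exp (-e) ≤ Real.exp (-ε n) := Real.exp_le_exp.2 (neg_le_neg hn.le)
  have h2 : Real.exp (ε n) ≤ Real.exp e := Real.exp_le_exp.2 hn.le
  exact ⟨(mul_le_mul_of_nonneg_left h1 hA.le).trans hr.1,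
    hr.2.trans (mul_le_mul_of_nonneg_left h2 hA.le)⟩

end

end Density

/-! ### Maximal inequality and Borel–Cantelli for the proportion of bad sets in balls. -/

section MaximalInequality

open Set Metric

/-- The weak type inequality for the maximal function of a finite measure on `ℝ^d`. -/
theorem volume_exists_lt_measure_closedBall_le {d : ℕ} (μ : Measure (EuclideanSpace ℝ (Fin d)))
    {lam : ℝ≥0∞} (h0 : lam ≠ 0) (htop : lam ≠ ⊤) :
    volume {y | ∃ r : ℝ, 0 < r ∧ r ≤ 1 ∧ lam * ENNReal.ofReal (r ^ d) < μ (closedBall y r)} ≤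
      5 ^ d * volume (ball (0 : EuclideanSpace ℝ (Fin d)) 1) * (μ univ / lam) := by
  set S := {y | ∃ r : ℝ, 0 < r ∧ r ≤ 1 ∧ lam * ENNReal.ofReal (r ^ d) < μ (closedBall y r)} with hS
  choose! r hr0 hr1 hr using fun y (hy : y ∈ S) => hy
  obtain ⟨u, huS, hdisj, hcov⟩ := Vitali.exists_disjoint_subfamily_covering_enlargement_closedBall
    S (fun y => y) r 1 hr1 5 (by norm_num)
  have hucount : u.Countable := by
    refine hdisj.countable_of_nonempty_interior fun y hy => ?_
    exact ⟨y, ball_subset_interior_closedBall (mem_ball_self (hr0 y (huS hy)))⟩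
  have hsub : S ⊆ ⋃ y ∈ u, closedBall y (5 * r y) := by
    intro y hy
    obtain ⟨b, hb, hyb⟩ := hcov y hy
    exact mem_iUnion₂.2 ⟨b, hb, hyb (mem_closedBall_self (hr0 y hy).le)⟩
  have hball : ∀ y ∈ u, volume (closedBall y (5 * r y)) ≤
      5 ^ d * volume (ball (0 : EuclideanSpace ℝ (Fin d)) 1) * (μ (closedBall y (r y)) / lam) := by
    intro y hy
    have hry := hr0 y (huS hy)
    rw [Measure.addHaar_closedBall volume _ (by positivity), finrank_euclideanSpace_fin, mul_pow,
      ENNReal.ofReal_mul (by positivity), mul_assoc, mul_assoc, ENNReal.ofReal_pow (by norm_num),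
      ENNReal.ofReal_ofNat, mul_comm (volume _)]
    gcongr
    rw [ENNReal.le_div_iff_mul_le (Or.inl h0) (Or.inl htop), mul_comm]
    exact (hr y (huS hy)).le
  calc volume S ≤ volume (⋃ y ∈ u, closedBall y (5 * r y)) := measure_mono hsub
    _ ≤ ∑' y : u, volume (closedBall (y : EuclideanSpace ℝ (Fin d)) (5 * r y)) :=
        measure_biUnion_le _ hucount _
    _ ≤ ∑' y : u, 5 ^ d * volume (ball (0 : EuclideanSpace ℝ (Fin d)) 1) *
          (μ (closedBall y (r y)) / lam) := ENNReal.tsum_le_tsum fun y => hball y y.2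
    _ = 5 ^ d * volume (ball (0 : EuclideanSpace ℝ (Fin d)) 1) *
          ((∑' y : u, μ (closedBall y (r y))) / lam) := by
        simp only [ENNReal.tsum_mul_left, div_eq_mul_inv, ENNReal.tsum_mul_right]
    _ ≤ _ := by
        gcongr
        rw [← measure_biUnion hucount hdisj fun y _ => measurableSet_closedBall]
        exact measure_mono (subset_univ _)

variable {X : Type*} [EMetricSpace X] [MeasurableSpace X] [BorelSpace X] {d : ℕ} {ν : Measure X}

/-- If the measures of the sets `F k` are summable relative to `lam k`, then almost every point is
a point of density zero of these sets, with rate `lam k`, uniformly over all small radii. -/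
theorem IsBilipschitzChart.ae_eventually_measure_inter_le {K : ℝ≥0} {W : Set X}
    {ψ : X → EuclideanSpace ℝ (Fin d)} (h : IsBilipschitzChart K W ψ) (hK : 0 < K)
    [IsFiniteMeasure ν] (hν : ν ≪ Measure.euclideanHausdorffMeasure d) {F : ℕ → Set X}
    {lam : ℕ → ℝ} (hlam : ∀ k, 0 < lam k)
    (hsum : Summable fun k => ν.real (F k) / lam k) :
    ∀ᵐ x ∂ν, x ∈ W → ∃ C r₀ : ℝ, 0 < C ∧ 0 < r₀ ∧ ∀ᶠ k in atTop, ∀ r : ℝ, 0 < r → r ≤ r₀ →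
      ν.real (closedEBall x (ENNReal.ofReal r) ∩ F k) ≤ C * lam k * r ^ d := by
  have hKr : (0 : ℝ) < K := hK
  -- The sets `F k` are not assumed measurable; a measurable hull has the same measure.
  set G : ℕ → Set X := fun k => toMeasurable ν (F k) with hG
  set μ : ℕ → Measure (EuclideanSpace ℝ (Fin d)) := fun k => ((ν.restrict (G k)).restrict W).map ψ
    with hμ
  -- The set where the maximal function of `μ k` exceeds `lam k` has volume at most a constant times
  -- `ν (F k) / lam k`. These bounds are summable, so almost every point lies in finitely many of
  -- the sets.
  have hbad : ∀ᵐ y : EuclideanSpace ℝ (Fin d), ∀ᶠ k in atTop,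
      y ∉ {y | ∃ r : ℝ, 0 < r ∧ r ≤ 1 ∧
        ENNReal.ofReal (lam k) * ENNReal.ofReal (r ^ d) < μ k (closedBall y r)} := by
    apply ae_eventually_notMem
    have hle : ∀ k, volume {y : EuclideanSpace ℝ (Fin d) | ∃ r : ℝ, 0 < r ∧ r ≤ 1 ∧
        ENNReal.ofReal (lam k) * ENNReal.ofReal (r ^ d) < μ k (closedBall y r)} ≤
        5 ^ d * volume (ball (0 : EuclideanSpace ℝ (Fin d)) 1) *
          ENNReal.ofReal (ν.real (F k) / lam k) := by
      intro k
      refine (volume_exists_lt_measure_closedBall_le (μ k)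
        (ENNReal.ofReal_pos.2 (hlam k)).ne' ENNReal.ofReal_ne_top).trans ?_
      gcongr
      rw [ENNReal.ofReal_div_of_pos (hlam k), ofReal_measureReal]
      gcongr
      rw [hμ, Measure.map_apply_of_aemeasurable (h.aemeasurable _) MeasurableSet.univ, preimage_univ,
        Measure.restrict_apply MeasurableSet.univ, ← measure_toMeasurable (F k)]
      exact (measure_mono (subset_univ _)).trans_eq (Measure.restrict_apply_univ _)
    refine ne_top_of_le_ne_top ?_ (ENNReal.tsum_le_tsum hle)
    rw [ENNReal.tsum_mul_left]
    refine ENNReal.mul_ne_top (ENNReal.mul_ne_top (by finiteness) measure_ball_lt_top.ne) ?_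
    exact hsum.tsum_ofReal_ne_top
  filter_upwards [h.ae_of_ae_volume hν hbad] with x hx hxW
  obtain ⟨r₁, hr₁, hsub⟩ := h.exists_closedEBall_subset hxW
  -- The bound `r ≤ K⁻¹` keeps the Euclidean radius `K r` at most `1`, as the truncated maximal
  -- function requires.
  refine ⟨(K : ℝ) ^ d, min r₁ (K : ℝ)⁻¹, by positivity, by positivity, ?_⟩
  filter_upwards [hx hxW] with k hk r hr0 hr
  simp only [not_exists, not_and, not_lt] at hk
  have hKr1 : K * r ≤ 1 := by
    have := hr.trans (min_le_right _ _)
    rwa [le_inv_comm₀ hr0 hKr, ← one_div, le_div_iff₀ hr0] at this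
  have h1 := hk (K * r) (by positivity) hKr1
  have h2 : closedEBall x (ENNReal.ofReal r) ⊆ W ∩ ψ ⁻¹' (closedBall (ψ x) (K * r)) :=
    h.mapsTo_closedEBall hr0.le ((closedEBall_subset_closedEBall
      (ENNReal.ofReal_le_ofReal (hr.trans (min_le_left _ _)))).trans hsub)
  have h3 : ν (closedEBall x (ENNReal.ofReal r) ∩ F k) ≤
      ENNReal.ofReal (lam k * (K * r) ^ d) := by
    rw [ENNReal.ofReal_mul (hlam k).le]
    refine le_trans ?_ h1
    rw [hμ, Measure.map_apply_of_aemeasurable (h.aemeasurable _) measurableSet_closedBall,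
      Measure.restrict_apply' h.isOpen_source.measurableSet,
      Measure.restrict_apply' (measurableSet_toMeasurable _ _)]
    refine measure_mono fun y hy => ⟨⟨(h2 hy.1).2, (h2 hy.1).1⟩, subset_toMeasurable ν _ hy.2⟩
  refine (ENNReal.toReal_le_of_le_ofReal (by have := hlam k; positivity) h3).trans_eq ?_
  rw [mul_pow]
  ring

theorem HasBilipschitzCharts.ae_eventually_measure_inter_le (hX : HasBilipschitzCharts d X)
    [IsFiniteMeasure ν] (hν : ν ≪ Measure.euclideanHausdorffMeasure d) {F : ℕ → Set X}
    {lam : ℕ → ℝ} (hlam : ∀ k, 0 < lam k)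
    (hsum : Summable fun k => ν.real (F k) / lam k) :
    ∀ᵐ x ∂ν, ∃ C r₀ : ℝ, 0 < C ∧ 0 < r₀ ∧ ∀ᶠ k in atTop, ∀ r : ℝ, 0 < r → r ≤ r₀ →
      ν.real (closedEBall x (ENNReal.ofReal r) ∩ F k) ≤ C * lam k * r ^ d :=
  hX.ae_of_forall_chart hν one_lt_two fun _ _ hW =>
    hW.ae_eventually_measure_inter_le two_pos hν hlam hsum

end MaximalInequality

/-! ### Geometric decay of the measure of thin annuli. -/

section AnnularDecay

open Set Metric

/-- In a length space, a point at any given smaller distance from `y` can be found on an almost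
minimizing path from `x` to `y`. -/
def IsLengthSpace (X : Type*) [EMetricSpace X] : Prop :=
  ∀ (x y : X) (s ε : ℝ≥0∞), s ≤ edist x y → edist x y ≠ ⊤ → ε ≠ 0 →
    ∃ z, edist z y = s ∧ edist x z + s ≤ edist x y + ε

theorem toReal_edist_triangle {X : Type*} [EMetricSpace X] {a b c : X} (h₁ : edist a b ≠ ⊤)
    (h₂ : edist b c ≠ ⊤) :
    (edist a c).toReal ≤ (edist a b).toReal + (edist b c).toReal := by
  rw [← ENNReal.toReal_add h₁ h₂]
  exact ENNReal.toReal_mono (ENNReal.add_ne_top.2 ⟨h₁, h₂⟩) (edist_triangle a b c)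

/-- The closed annulus with outer radius `r` and width `s` around `x`. -/
def annulus {X : Type*} [EMetricSpace X] (x : X) (r s : ℝ) : Set X :=
  {y | ENNReal.ofReal (r - s) ≤ edist y x ∧ edist y x ≤ ENNReal.ofReal r}

variable {X : Type*} [EMetricSpace X] {d : ℕ}

theorem mem_annulus_iff {x y : X} {r s : ℝ} (hr : 0 ≤ r) :
    y ∈ annulus x r s ↔
      edist y x ≠ ⊤ ∧ r - s ≤ (edist y x).toReal ∧ (edist y x).toReal ≤ r := by
  constructor
  · rintro ⟨h1, h2⟩
    have hfin := ne_top_of_le_ne_top ENNReal.ofReal_ne_top h2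
    exact ⟨hfin, (ENNReal.ofReal_le_iff_le_toReal hfin).1 h1, ENNReal.toReal_le_of_le_ofReal hr h2⟩
  · rintro ⟨hfin, h1, h2⟩
    exact ⟨(ENNReal.ofReal_le_iff_le_toReal hfin).2 h1,
      (ENNReal.le_ofReal_iff_toReal_le hfin hr).2 h2⟩

theorem annulus_subset_closedEBall (x : X) (r s : ℝ) :
    annulus x r s ⊆ closedEBall x (ENNReal.ofReal r) := fun _ hy => hy.2

theorem annulus_subset_annulus {x : X} {r s s' : ℝ} (h : s ≤ s') :
    annulus x r s ⊆ annulus x r s' := fun _ hy =>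
  ⟨(ENNReal.ofReal_le_ofReal (by linarith)).trans hy.1, hy.2⟩

/-- Moving inwards from a point of a thin annulus one finds a ball of comparable size in the part
of a thicker annulus that the thin one leaves. -/
theorem IsLengthSpace.exists_closedEBall_subset_annulus_diff (hX : IsLengthSpace X) {x y : X}
    {r s : ℝ} (hs : 0 < s) (hsr : 4 * s ≤ r) (hy : y ∈ annulus x r s) :
    ∃ z, edist y z = ENNReal.ofReal (2 * s) ∧ edist z x ≤ ENNReal.ofReal r ∧
      closedEBall z (ENNReal.ofReal (s / 2)) ⊆ annulus x r (4 * s) \ annulus x r s := by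
  have hr : 0 ≤ r := by linarith
  obtain ⟨hfin, h1, h2⟩ := (mem_annulus_iff hr).1 hy
  rw [edist_comm] at hfin h1 h2
  -- The slack `s / 4` puts `z` at distance between `r - 3 s` and `r - 7 s / 4` from `x`. The ball
  -- of radius `s / 2` around `z` then avoids the annulus of width `s` and stays in the one of width
  -- `4 s`.
  obtain ⟨z, hz1, hz2⟩ := hX x y (ENNReal.ofReal (2 * s)) (ENNReal.ofReal (s / 4))
    ((ENNReal.ofReal_le_iff_le_toReal hfin).2 (by linarith)) hfin
    (ENNReal.ofReal_pos.2 (by positivity)).ne'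
  have hxz : edist x z ≠ ⊤ := by
    refine ne_top_of_le_ne_top ?_ ((le_add_right le_rfl).trans hz2)
    finiteness
  have hzy : edist z y ≠ ⊤ := by rw [hz1]; finiteness
  have hz1' : (edist z y).toReal = 2 * s := by rw [hz1, ENNReal.toReal_ofReal (by positivity)]
  have hz2' : (edist x z).toReal + 2 * s ≤ (edist x y).toReal + s / 4 := by
    have := ENNReal.toReal_mono (by finiteness) hz2
    rwa [ENNReal.toReal_add hxz (by finiteness), ENNReal.toReal_add hfin (by finiteness),
      ENNReal.toReal_ofReal (by positivity), ENNReal.toReal_ofReal (by positivity)] at this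
  refine ⟨z, by rw [edist_comm, hz1], ?_, fun w hw => ?_⟩
  · rw [edist_comm]
    exact (ENNReal.le_ofReal_iff_toReal_le hxz hr).2 (by linarith)
  · rw [mem_closedEBall] at hw
    have hwz : edist w z ≠ ⊤ := ne_top_of_le_ne_top ENNReal.ofReal_ne_top hw
    have hwz' : (edist w z).toReal ≤ s / 2 := ENNReal.toReal_le_of_le_ofReal (by positivity) hw
    have hzx : edist z x ≠ ⊤ := by rwa [edist_comm]
    have hwx : edist w x ≠ ⊤ :=
      ne_top_of_le_ne_top (ENNReal.add_ne_top.2 ⟨hwz, hzx⟩) (edist_triangle w z x)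
    have t1 := toReal_edist_triangle hwz hzx
    have hzw : edist z w ≠ ⊤ := by rwa [edist_comm]
    have t2 := toReal_edist_triangle hxz hzy
    have t3 := toReal_edist_triangle (a := x) (b := w) (c := z) (by rwa [edist_comm]) hwz
    rw [edist_comm z x] at t1
    rw [edist_comm x w] at t3
    refine ⟨(mem_annulus_iff hr).2 ⟨hwx, by linarith, by linarith⟩, fun hmem => ?_⟩
    have := ((mem_annulus_iff hr).1 hmem).2.1
    linarith

variable [MeasurableSpace X] [BorelSpace X]

theorem measurableSet_annulus (x : X) (r s : ℝ) : MeasurableSet (annulus x r s) := by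
  have hc : Continuous fun y : X => edist y x := continuous_id.edist continuous_const
  exact ((isClosed_le continuous_const hc).inter (isClosed_le hc continuous_const)).measurableSet

/-- Near `x`, balls of radius `r` have measure comparable to `r ^ d`. -/
def IsRegularAt (m : Measure X) (d : ℕ) (x : X) (c C r₀ : ℝ) : Prop :=
  ∀ z, edist z x ≤ ENNReal.ofReal r₀ → ∀ r : ℝ, 0 < r → r ≤ r₀ →
    ENNReal.ofReal (c * r ^ d) ≤ m (closedEBall z (ENNReal.ofReal r)) ∧
      m (closedEBall z (ENNReal.ofReal r)) ≤ ENNReal.ofReal (C * r ^ d)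

/-- The upper bound maps the ball into a Euclidean ball of radius `K r`. The lower bound needs the
Euclidean ball of radius `r / K` to lie inside the chart image, which is open. Both constants lose
`K ^ d` twice, once for the radius and once for the measure. -/
theorem IsBilipschitzChart.exists_isRegularAt {K : ℝ≥0} {W : Set X}
    {ψ : X → EuclideanSpace ℝ (Fin d)} (h : IsBilipschitzChart K W ψ) (hK : 1 ≤ K) {x : X}
    (hx : x ∈ W) : ∃ c C r₀ : ℝ, 0 < c ∧ 0 < C ∧ 0 < r₀ ∧
      IsRegularAt (Measure.euclideanHausdorffMeasure d) d x c C r₀ := by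
  have hK0 : (0 : ℝ) < K := zero_lt_one.trans_le hK
  have hK1 : (1 : ℝ) ≤ K := hK
  obtain ⟨r₁, hr₁, hsub⟩ := h.exists_closedEBall_subset hx
  obtain ⟨r₂, hr₂, hsub₂⟩ := Metric.isOpen_iff.1 h.isOpen_target (ψ x) (mem_image_of_mem _ hx)
  set v := volume.real (ball (0 : EuclideanSpace ℝ (Fin d)) 1) with hv
  have hv0 : 0 < v := ENNReal.toReal_pos (measure_ball_pos _ _ one_pos).ne' measure_ball_lt_top.ne
  have hball : ∀ (y : EuclideanSpace ℝ (Fin d)) (r : ℝ), 0 ≤ r →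
      volume (closedBall y r) = ENNReal.ofReal (r ^ d * v) := by
    intro y r hr
    rw [Measure.addHaar_closedBall volume _ hr, finrank_euclideanSpace_fin,
      ENNReal.ofReal_mul (by positivity), hv, ofReal_measureReal measure_ball_lt_top.ne]
  have hKe : (K : ℝ≥0∞) ^ d = ENNReal.ofReal ((K : ℝ) ^ d) := by
    rw [ENNReal.ofReal_pow hK0.le, ENNReal.ofReal_coe_nnreal]
  refine ⟨((K : ℝ) ^ d)⁻¹ * ((K : ℝ) ^ d)⁻¹ * v, (K : ℝ) ^ d * K ^ d * v,
    min (r₁ / 2) (r₂ / (4 * K)), by positivity, by positivity, by positivity, ?_⟩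
  intro z hz r hr0 hr
  have hr₁' : r ≤ r₁ / 2 := hr.trans (min_le_left _ _)
  have hr₂' : r ≤ r₂ / (4 * K) := hr.trans (min_le_right _ _)
  have hsubz : closedEBall z (ENNReal.ofReal r) ⊆ W := by
    refine Subset.trans (fun y hy => ?_) hsub
    rw [mem_closedEBall] at hy ⊢
    calc edist y x ≤ edist y z + edist z x := edist_triangle _ _ _
      _ ≤ ENNReal.ofReal (r₁ / 2) + ENNReal.ofReal (r₁ / 2) :=
          add_le_add (hy.trans (ENNReal.ofReal_le_ofReal hr₁'))
            (hz.trans (ENNReal.ofReal_le_ofReal (min_le_left _ _)))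
      _ = ENNReal.ofReal r₁ := by
          rw [← ENNReal.ofReal_add (by positivity) (by positivity), add_halves]
  have hzW : z ∈ W := hsubz (by simp)
  constructor
  · have hballsub : closedBall (ψ z) (r / K) ⊆ ψ '' W := by
      refine Subset.trans (fun y hy => ?_) hsub₂
      rw [mem_closedBall] at hy
      rw [mem_ball]
      have h1 : dist (ψ z) (ψ x) ≤ K * (r₂ / (4 * K)) := by
        rw [← ENNReal.ofReal_le_ofReal_iff (by positivity), ← edist_dist,
          ENNReal.ofReal_mul K.coe_nonneg, ENNReal.ofReal_coe_nnreal]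
        refine (h.edist_map_le z hzW x hx).trans ?_
        gcongr
        exact hz.trans (ENNReal.ofReal_le_ofReal (min_le_right _ _))
      have h2 : K * (r₂ / (4 * K)) = r₂ / 4 := by field_simp
      have h3 : r / K ≤ r₂ / 4 := by
        calc r / K ≤ r := div_le_self hr0.le hK1
          _ ≤ r₂ / (4 * K) := hr₂'
          _ ≤ r₂ / 4 := by
            apply div_le_div_of_nonneg_left hr₂.le (by norm_num)
            linarith
      calc dist y (ψ x) ≤ dist y (ψ z) + dist (ψ z) (ψ x) := dist_triangle _ _ _
        _ ≤ r₂ / 4 + r₂ / 4 := add_le_add (hy.trans h3) (h1.trans h2.le)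
        _ < r₂ := by linarith
    have himg : closedBall (ψ z) (r / K) = ψ '' (W ∩ ψ ⁻¹' closedBall (ψ z) (r / K)) := by
      rw [image_inter_preimage, inter_eq_right.2 hballsub]
    have h1 : volume (closedBall (ψ z) (r / K)) ≤
        (K : ℝ≥0∞) ^ d * Measure.euclideanHausdorffMeasure d (closedEBall z (ENNReal.ofReal r)) := by
      rw [himg, ← EuclideanSpace.euclideanHausdorffMeasure_eq_volume]
      refine (euclideanHausdorffMeasure_image_le
        (h.lipschitzOnWith.mono inter_subset_left) d).trans ?_
      gcongr
      exact h.inter_preimage_subset hK0 hzW r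
    have hKd : (K : ℝ≥0∞) ^ d ≠ 0 := by
      rw [hKe]
      exact (ENNReal.ofReal_pos.2 (by positivity)).ne'
    have hKd' : (K : ℝ≥0∞) ^ d ≠ ⊤ := by finiteness
    rw [mul_comm, ← ENNReal.div_le_iff hKd hKd', hball _ _ (by positivity), hKe,
      ← ENNReal.ofReal_div_of_pos (by positivity)] at h1
    refine le_trans (ENNReal.ofReal_le_ofReal (le_of_eq ?_)) h1
    rw [div_pow]
    field_simp
  · refine (measure_mono (h.mapsTo_closedEBall hr0.le hsubz)).trans
      ((h.measure_inter_preimage_le _).trans_eq ?_)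
    rw [hball _ _ (by positivity), hKe, ← ENNReal.ofReal_mul (by positivity)]
    congr 1
    rw [mul_pow]
    ring

theorem HasBilipschitzCharts.ae_exists_isRegularAt (hX : HasBilipschitzCharts d X) {ν : Measure X}
    (hν : ν ≪ Measure.euclideanHausdorffMeasure d) :
    ∀ᵐ x ∂ν, ∃ c C r₀ : ℝ, 0 < c ∧ 0 < C ∧ 0 < r₀ ∧
      IsRegularAt (Measure.euclideanHausdorffMeasure d) d x c C r₀ :=
  hX.ae_of_forall_chart hν one_lt_two fun _ _ hW =>
    Eventually.of_forall fun _ hx => hW.exists_isRegularAt one_le_two hx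

variable [SecondCountableTopology X]

/-- Each point of the thin annulus has a ball of radius `s / 2` just inside it, with centre at
distance `2 s`. For a maximal disjoint subfamily the concentric balls of radius `3 s` cover the
annulus, and regularity compares radii with ratio `6`. -/
theorem IsLengthSpace.measure_annulus_le (hX : IsLengthSpace X) {m : Measure X} {x : X}
    {c C r₀ : ℝ} (hc : 0 < c) (hC : 0 < C) (hm : IsRegularAt m d x c C r₀) {r s : ℝ} (hs : 0 < s)
    (hsr : 4 * s ≤ r) (hr : r ≤ r₀) :
    m (annulus x r s) ≤
      ENNReal.ofReal (C * 6 ^ d / c) * m (annulus x r (4 * s) \ annulus x r s) := by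
  choose! z hz1 hz2 hz3 using fun y (hy : y ∈ annulus x r s) =>
    hX.exists_closedEBall_subset_annulus_diff hs hsr hy
  obtain ⟨u, huA, hdisj, hcov⟩ := Vitali.exists_disjoint_subfamily_covering_enlargement
    (fun y => closedEBall (z y) (ENNReal.ofReal (s / 2))) (annulus x r s) (fun _ => (1 : ℝ)) 2
    one_lt_two (fun _ _ => zero_le_one) 1 (fun _ _ => le_rfl) (fun y _ => ⟨z y, by simp⟩)
  have hs2 : (0 : ℝ≥0∞) < ENNReal.ofReal (s / 2) := ENNReal.ofReal_pos.2 (by positivity)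
  have hucount : u.Countable := by
    refine hdisj.countable_of_nonempty_interior fun y hy => ⟨z y, ?_⟩
    exact mem_interior.2 ⟨eball (z y) (ENNReal.ofReal (s / 2)), eball_subset_closedEBall,
      isOpen_eball, mem_eball_self hs2⟩
  have hsub : annulus x r s ⊆ ⋃ y ∈ u, closedEBall (z y) (ENNReal.ofReal (3 * s)) := by
    intro y hy
    obtain ⟨b, hb, ⟨w, hw1, hw2⟩, -⟩ := hcov y hy
    refine mem_iUnion₂.2 ⟨b, hb, ?_⟩
    rw [mem_closedEBall] at hw1 hw2 ⊢
    calc edist y (z b) ≤ edist y (z y) + edist (z y) w + edist w (z b) := edist_triangle4 _ _ _ _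
      _ ≤ ENNReal.ofReal (2 * s) + ENNReal.ofReal (s / 2) + ENNReal.ofReal (s / 2) := by
          gcongr
          · exact (hz1 y hy).le
          · rwa [edist_comm]
      _ = ENNReal.ofReal (3 * s) := by
          rw [← ENNReal.ofReal_add (by positivity) (by positivity),
            ← ENNReal.ofReal_add (by positivity) (by positivity)]
          congr 1
          ring
  have hball : ∀ y ∈ u, m (closedEBall (z y) (ENNReal.ofReal (3 * s))) ≤
      ENNReal.ofReal (C * 6 ^ d / c) * m (closedEBall (z y) (ENNReal.ofReal (s / 2))) := by
    intro y hy
    have hzr : edist (z y) x ≤ ENNReal.ofReal r₀ :=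
      (hz2 y (huA hy)).trans (ENNReal.ofReal_le_ofReal hr)
    refine (hm (z y) hzr (3 * s) (by positivity) (by linarith)).2.trans ?_
    refine le_trans ?_ (mul_le_mul_right (hm (z y) hzr (s / 2) (by positivity) (by linarith)).1 _)
    rw [← ENNReal.ofReal_mul (by positivity)]
    refine ENNReal.ofReal_le_ofReal (le_of_eq ?_)
    have : (3 * s) ^ d = 6 ^ d * (s / 2) ^ d := by
      rw [← mul_pow]
      congr 1
      ring
    rw [this]
    field_simp
  calc m (annulus x r s) ≤ m (⋃ y ∈ u, closedEBall (z y) (ENNReal.ofReal (3 * s))) :=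
        measure_mono hsub
    _ ≤ ∑' y : u, m (closedEBall (z y) (ENNReal.ofReal (3 * s))) :=
        measure_biUnion_le _ hucount _
    _ ≤ ∑' y : u, ENNReal.ofReal (C * 6 ^ d / c) *
          m (closedEBall (z y) (ENNReal.ofReal (s / 2))) :=
        ENNReal.tsum_le_tsum fun y => hball y y.2
    _ = ENNReal.ofReal (C * 6 ^ d / c) *
          m (⋃ y ∈ u, closedEBall (z y) (ENNReal.ofReal (s / 2))) := by
        rw [ENNReal.tsum_mul_left,
          measure_biUnion hucount hdisj fun y _ => isClosed_closedEBall.measurableSet]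
    _ ≤ _ := by
        gcongr
        exact iUnion₂_subset fun y hy => hz3 y (huA hy)

/-- The annular decay property of length spaces with regular measures. -/
theorem IsLengthSpace.exists_measure_annulus_le (hX : IsLengthSpace X) {m : Measure X} {x : X}
    {c C r₀ : ℝ} (hc : 0 < c) (hC : 0 < C) (hm : IsRegularAt m d x c C r₀) :
    ∃ q : ℝ, 0 < q ∧ q < 1 ∧ ∀ r : ℝ, 0 < r → r ≤ r₀ → ∀ j : ℕ,
      m (annulus x r (r / 4 ^ j)) ≤ ENNReal.ofReal (q ^ j * (C * r ^ d)) := by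
  set κ := C * 6 ^ d / c with hκ
  have hκ0 : 0 < κ := by positivity
  -- From `m(A_s) ≤ κ (m(A_{4s}) - m(A_s))` follows `m(A_s) ≤ κ / (1 + κ) * m(A_{4s})`: quartering
  -- the width gains a fixed factor below one.
  refine ⟨κ / (1 + κ), by positivity, (div_lt_one (by positivity)).2 (by linarith), ?_⟩
  intro r hr0 hr j
  have hx0 : edist x x ≤ ENNReal.ofReal r₀ := by simp
  have hball := (hm x hx0 r hr0 hr).2
  induction j with
  | zero =>
    simp only [pow_zero, one_mul]
    exact (measure_mono (annulus_subset_closedEBall _ _ _)).trans hball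
  | succ j ih =>
    set s := r / 4 ^ (j + 1) with hs
    have hs0 : 0 < s := by positivity
    have h4s : 4 * s = r / 4 ^ j := by
      rw [hs, pow_succ]
      field_simp
    have hsr : 4 * s ≤ r := by
      rw [h4s]
      exact div_le_self hr0.le (one_le_pow₀ (by norm_num))
    have hsub : annulus x r s ⊆ annulus x r (4 * s) := annulus_subset_annulus (by linarith)
    have hfin : m (annulus x r (4 * s)) ≠ ⊤ := by
      rw [h4s]
      exact ne_top_of_le_ne_top ENNReal.ofReal_ne_top ih
    have hfin' : m (annulus x r s) ≠ ⊤ := measure_ne_top_of_subset hsub hfin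
    have key := hX.measure_annulus_le hc hC hm hs0 hsr hr
    rw [measure_sdiff hsub (measurableSet_annulus _ _ _).nullMeasurableSet hfin'] at key
    have key' : m.real (annulus x r s) ≤ κ * (m.real (annulus x r (4 * s)) -
        m.real (annulus x r s)) := by
      have := ENNReal.toReal_mono (by finiteness) key
      rwa [ENNReal.toReal_mul, ENNReal.toReal_ofReal hκ0.le,
        ENNReal.toReal_sub_of_le (measure_mono hsub) hfin] at this
    have ih' : m.real (annulus x r (4 * s)) ≤ (κ / (1 + κ)) ^ j * (C * r ^ d) := by
      rw [h4s]
      exact ENNReal.toReal_le_of_le_ofReal (by positivity) ih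
    rw [← ofReal_measureReal hfin']
    refine ENNReal.ofReal_le_ofReal ?_
    have h1 : m.real (annulus x r s) ≤ κ / (1 + κ) * m.real (annulus x r (4 * s)) := by
      rw [div_mul_eq_mul_div, le_div_iff₀ (by positivity)]
      linarith
    calc m.real (annulus x r s) ≤ κ / (1 + κ) * m.real (annulus x r (4 * s)) := h1
      _ ≤ κ / (1 + κ) * ((κ / (1 + κ)) ^ j * (C * r ^ d)) := by gcongr
      _ = _ := by rw [pow_succ]; ring

/-- A measure with an `L^{1+δ}` density is controlled by a power of the reference measure. -/
theorem HasLpDensity.exists_measure_le {X : Type*} [MeasurableSpace X] {m ν : Measure X} {δ : ℝ}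
    (h : HasLpDensity m ν δ) (hδ : 0 < δ) :
    ∃ B : ℝ≥0∞, B ≠ ⊤ ∧ ∀ S, MeasurableSet S → ν S ≤ B * m S ^ (δ / (1 + δ)) := by
  obtain ⟨ρ, hρ0, hρm, hρ, rfl⟩ := h
  refine ⟨eLpNorm ρ (ENNReal.ofReal (1 + δ)) m, hρ.2.ne, fun S hS => ?_⟩
  have h1 : (1 : ℝ≥0∞) ≤ ENNReal.ofReal (1 + δ) := by
    rw [← ENNReal.ofReal_one]
    exact ENNReal.ofReal_le_ofReal (by linarith)
  -- Hölder's inequality on `S` between the exponents `1` and `1 + δ`, whence the power `1 - 1 / (1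
  -- + δ)`.
  have h2 := eLpNorm_le_eLpNorm_mul_rpow_measure_univ (μ := m.restrict S) h1
    hρm.aestronglyMeasurable
  rw [withDensity_apply _ hS]
  calc ∫⁻ x in S, ENNReal.ofReal (ρ x) ∂m = eLpNorm ρ 1 (m.restrict S) := by
        rw [eLpNorm_one_eq_lintegral_enorm]
        refine lintegral_congr fun x => ?_
        rw [Real.enorm_of_nonneg (hρ0 x)]
    _ ≤ _ := h2
    _ ≤ _ := by
        rw [Measure.restrict_apply_univ, ENNReal.toReal_one,
          ENNReal.toReal_ofReal (by linarith)]
        have : (1 : ℝ) / 1 - 1 / (1 + δ) = δ / (1 + δ) := by field_simp; ring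
        rw [this]
        gcongr
        exact Measure.restrict_le_self

/-- Almost every point has thin annuli of exponentially small measure. -/
theorem HasBilipschitzCharts.ae_exists_annulus_le (hX : HasBilipschitzCharts d X)
    (hlen : IsLengthSpace X) {ν : Measure X} [IsFiniteMeasure ν] {δ : ℝ} (hδ : 0 < δ)
    (hν : HasLpDensity (Measure.euclideanHausdorffMeasure d) ν δ) :
    ∀ᵐ x ∂ν, ∃ θ C r₀ : ℝ, 0 < θ ∧ θ < 1 ∧ 0 < C ∧ 0 < r₀ ∧ ∀ r : ℝ, 0 < r → r ≤ r₀ →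
      ∀ j : ℕ, ν.real (annulus x r (r / 4 ^ j)) ≤ C * θ ^ j := by
  have hac : ν ≪ Measure.euclideanHausdorffMeasure d := by
    obtain ⟨ρ, -, -, -, rfl⟩ := hν
    exact withDensity_absolutelyContinuous _ _
  obtain ⟨B, hB, hνB⟩ := hν.exists_measure_le hδ
  filter_upwards [hX.ae_exists_isRegularAt hac] with x hx
  obtain ⟨c, C, r₀, hc, hC, hr₀, hm⟩ := hx
  obtain ⟨q, hq0, hq1, hq⟩ := hlen.exists_measure_annulus_le hc hC hm
  have he : 0 < δ / (1 + δ) := by positivity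
  refine ⟨q ^ (δ / (1 + δ)), B.toReal * (C * r₀ ^ d) ^ (δ / (1 + δ)) + 1, r₀,
    Real.rpow_pos_of_pos hq0 _, Real.rpow_lt_one hq0.le hq1 he, by positivity, hr₀, ?_⟩
  intro r hr0 hr j
  have h1 := hνB _ (measurableSet_annulus x r (r / 4 ^ j))
  set e := δ / (1 + δ) with he'
  have h2 : ν (annulus x r (r / 4 ^ j)) ≤ ENNReal.ofReal (B.toReal * (q ^ j * (C * r ^ d)) ^ e) := by
    rw [ENNReal.ofReal_mul ENNReal.toReal_nonneg, ENNReal.ofReal_toReal hB,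
      ← ENNReal.ofReal_rpow_of_pos (by positivity)]
    refine h1.trans ?_
    gcongr
    exact hq r hr0 hr j
  refine (ENNReal.toReal_le_of_le_ofReal (by positivity) h2).trans ?_
  have h3 : (q ^ j * (C * r ^ d)) ^ e = (C * r ^ d) ^ e * (q ^ e) ^ j := by
    rw [Real.mul_rpow (by positivity) (by positivity), mul_comm, Real.rpow_pow_comm hq0.le]
  rw [h3, ← mul_assoc]
  have h4 : (C * r ^ d) ^ e ≤ (C * r₀ ^ d) ^ e := by gcongr
  have h5 : 0 ≤ (q ^ e) ^ j := by positivity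
  refine mul_le_mul_of_nonneg_right ?_ h5
  have := mul_le_mul_of_nonneg_left h4 (ENNReal.toReal_nonneg (a := B))
  linarith

end AnnularDecay

/-! ### Recursion for the probability of avoiding a set. -/

section AvoidanceProbability

open Set Metric

variable {X : Type*}

/-- The points whose first `n` iterates, starting from the point itself, avoid `V`. -/
def avoidSet (f : X → X) (V : Set X) (n : ℕ) : Set X := {x | ∀ i < n, f^[i] x ∉ V}

theorem avoidSet_zero (f : X → X) (V : Set X) : avoidSet f V 0 = univ :=
  eq_univ_of_forall fun _ _ hi => absurd hi (Nat.not_lt_zero _)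

theorem avoidSet_succ (f : X → X) (V : Set X) (n : ℕ) :
    avoidSet f V (n + 1) = f ⁻¹' (avoidSet f V n) \ V := by
  ext x
  constructor
  · intro h
    exact ⟨fun i hi => by simpa using h (i + 1) (by omega), h 0 (by omega)⟩
  · rintro ⟨h1, h2⟩ i hi
    cases i with
    | zero => exact h2
    | succ i => simpa using h1 i (by omega)

theorem measurableSet_avoidSet [MeasurableSpace X] {f : X → X} (hf : Measurable f) {V : Set X}
    (hV : MeasurableSet V) (n : ℕ) : MeasurableSet (avoidSet f V n) := by
  induction n with
  | zero => rw [avoidSet_zero]; exact MeasurableSet.univ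
  | succ n ih => rw [avoidSet_succ]; exact (hf ih).diff hV

variable [MeasurableSpace X] {f : X → X} {ν : Measure X} [IsProbabilityMeasure ν]

/-- By invariance, avoiding `V` at times `1, …, n` is as likely as at times `0, …, n - 1`; time `0`
is then taken into account by removing `V`. -/
theorem measureReal_avoidSet_succ (hf : MeasurePreserving f ν ν) {V : Set X}
    (hV : MeasurableSet V) (n : ℕ) :
    ν.real (avoidSet f V (n + 1)) =
      ν.real (avoidSet f V n) - ν.real (V ∩ f ⁻¹' (avoidSet f V n)) := by
  have h1 : ν.real (f ⁻¹' (avoidSet f V n)) = ν.real (avoidSet f V n) :=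
    hf.measureReal_preimage (measurableSet_avoidSet hf.measurable hV n).nullMeasurableSet
  have h2 := measureReal_sdiff_add_inter (μ := ν) (s := f ⁻¹' (avoidSet f V n)) hV
  rw [avoidSet_succ, inter_comm, ← h1]
  linarith

theorem avoidSet_add_sub_le (hf : MeasurePreserving f ν ν) {V : Set X}
    (hV : MeasurableSet V) (n t : ℕ) :
    ν.real (avoidSet f V n) - ν.real (avoidSet f V (n + t)) ≤ t * ν.real V := by
  induction t with
  | zero => simp
  | succ t ih =>
    have h1 := measureReal_avoidSet_succ hf hV (n + t)
    have h2 : ν.real (V ∩ f ⁻¹' (avoidSet f V (n + t))) ≤ ν.real V :=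
      measureReal_mono inter_subset_left
    rw [← add_assoc]
    push_cast
    linarith

theorem abs_measureReal_sub_le {A B D : Set X} (hAB : A ⊆ B) (hB : B ⊆ A ∪ D) :
    |ν.real A - ν.real B| ≤ ν.real D := by
  have h1 : ν.real A ≤ ν.real B := measureReal_mono hAB
  have h2 : ν.real B ≤ ν.real A + ν.real D :=
    (measureReal_mono hB).trans (measureReal_union_le _ _)
  rw [abs_le]
  constructor <;> linarith [measureReal_nonneg (μ := ν) (s := D)]

/-- If short returns to `V` are unlikely and `V` is almost independent of events that are `t + 1`
steps away, then the probability of avoiding `V` for `n` steps is close to `(1 - ν V) ^ n`. -/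
theorem abs_avoidSet_sub_pow_le (hf : MeasurePreserving f ν ν) {V : Set X}
    (hV : MeasurableSet V) (t : ℕ) {b c : ℝ}
    (hb : ν.real (V ∩ {x | ∃ j, 1 ≤ j ∧ j ≤ t ∧ f^[j] x ∈ V}) ≤ b)
    (hc : ∀ Y, MeasurableSet Y →
      |ν.real (V ∩ f^[t + 1] ⁻¹' Y) - ν.real V * ν.real Y| ≤ c) (n : ℕ) :
    |ν.real (avoidSet f V n) - (1 - ν.real V) ^ n| ≤ n * (b + c + t * ν.real V ^ 2) := by
  set R := V ∩ {x | ∃ j, 1 ≤ j ∧ j ≤ t ∧ f^[j] x ∈ V} with hR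
  set a := ν.real V with ha
  have ha0 : 0 ≤ a := measureReal_nonneg
  have ha1 : a ≤ 1 := measureReal_le_one
  have hstep : ∀ l, |ν.real (V ∩ f ⁻¹' (avoidSet f V l)) - a * ν.real (avoidSet f V l)| ≤
      b + c + t * a ^ 2 := by
    intro l
    -- Truncated subtraction is harmless: for `l < t` the set is the whole space, and all the
    -- neglected times fall in the short return window.
    have hYm := measurableSet_avoidSet hf.measurable hV (l - t)
    have e1 : |ν.real (V ∩ f ⁻¹' (avoidSet f V l)) -
        ν.real (V ∩ f^[t + 1] ⁻¹' (avoidSet f V (l - t)))| ≤ ν.real R := by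
      apply abs_measureReal_sub_le
      · rintro x ⟨hxV, hx⟩
        refine ⟨hxV, fun i hi => ?_⟩
        have := hx (i + t) (by omega)
        rw [← Function.iterate_succ_apply] at this
        rwa [← Function.iterate_add_apply, show i + (t + 1) = (i + t).succ by omega]
      · rintro x ⟨hxV, hx⟩
        by_cases hret : ∃ j, 1 ≤ j ∧ j ≤ t ∧ f^[j] x ∈ V
        · exact Or.inr ⟨hxV, hret⟩
        · left
          refine ⟨hxV, fun i hi => ?_⟩
          rw [← Function.iterate_succ_apply]
          by_cases hit : i < t
          · exact fun hmem => hret ⟨i.succ, by omega, by omega, hmem⟩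
          · have := hx (i - t) (by omega)
            rwa [← Function.iterate_add_apply, show i - t + (t + 1) = i.succ by omega] at this
    have e2 := hc _ hYm
    -- The `t` neglected times are put back, each changing the avoidance probability by at most `ν
    -- V`.
    have e3 : |a * ν.real (avoidSet f V (l - t)) - a * ν.real (avoidSet f V l)| ≤ t * a ^ 2 := by
      rw [← mul_sub, abs_mul, abs_of_nonneg ha0]
      have h0 : ν.real (avoidSet f V l) ≤ ν.real (avoidSet f V (l - t)) :=
        measureReal_mono fun x hx i hi => hx i (by omega)
      have h1 : ν.real (avoidSet f V (l - t)) - ν.real (avoidSet f V l) ≤ t * a := by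
        have h2 := avoidSet_add_sub_le hf hV (l - t) t
        have h3 : ν.real (avoidSet f V (l - t + t)) ≤ ν.real (avoidSet f V l) :=
          measureReal_mono fun x hx i hi => hx i (by omega)
        linarith
      rw [abs_of_nonneg (by linarith)]
      calc a * (ν.real (avoidSet f V (l - t)) - ν.real (avoidSet f V l)) ≤ a * (t * a) := by gcongr
        _ = t * a ^ 2 := by ring
    rw [abs_le] at e1 e2 e3 ⊢
    constructor <;> linarith [e1.1, e1.2, e2.1, e2.2, e3.1, e3.2]
  induction n with
  | zero => simp [avoidSet_zero]
  | succ n ih =>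
    have h1 := measureReal_avoidSet_succ hf hV n
    have h2 := hstep n
    set p := ν.real (avoidSet f V n)
    set e := b + c + t * a ^ 2
    -- The earlier error is multiplied by `1 - a ≤ 1`, so the one-step errors merely add.
    have e1 : ν.real (avoidSet f V (n + 1)) - (1 - a) ^ (n + 1) =
        (1 - a) * (p - (1 - a) ^ n) - (ν.real (V ∩ f ⁻¹' (avoidSet f V n)) - a * p) := by
      rw [h1, pow_succ]
      ring
    rw [e1]
    refine (abs_sub _ _).trans ?_
    rw [abs_mul, abs_of_nonneg (by linarith : (0 : ℝ) ≤ 1 - a)]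
    have h3 : (1 - a) * |p - (1 - a) ^ n| ≤ |p - (1 - a) ^ n| :=
      mul_le_of_le_one_left (abs_nonneg _) (by linarith)
    push_cast
    linarith

end AvoidanceProbability

/-! ### From correlations of Lipschitz functions to correlations of balls. -/

section Mixing

open Set Metric

variable {X : Type*} [EMetricSpace X]

/-- A Lipschitz approximation from below of the indicator of the open ball of radius `r`: it is
`1` on the ball of radius `r - s`. -/
noncomputable def ballCutoff (x₀ : X) (r s : ℝ) (x : X) : ℝ :=
  -- Truncating the distance at `r` before `toReal` makes points at infinite distance count as
  -- outside the ball, where the cutoff vanishes.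
  min 1 (max 0 ((r - (min (edist x x₀) (ENNReal.ofReal r)).toReal) / s))

theorem ballCutoff_nonneg (x₀ : X) (r s : ℝ) (x : X) : 0 ≤ ballCutoff x₀ r s x :=
  le_min zero_le_one (le_max_left _ _)

theorem ballCutoff_le_one (x₀ : X) (r s : ℝ) (x : X) : ballCutoff x₀ r s x ≤ 1 := min_le_left _ _

theorem lipschitzWith_ballCutoff (x₀ : X) (r : ℝ) {s : ℝ} (hs : 0 < s) :
    LipschitzWith (Real.toNNReal s⁻¹) (ballCutoff x₀ r s) := by
  have h1 : LipschitzWith 1 fun x : X => (min (edist x x₀) (ENNReal.ofReal r)).toReal := by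
    intro x y
    have hfin : ∀ x : X, min (edist x x₀) (ENNReal.ofReal r) ≠ ⊤ := fun x =>
      ne_top_of_le_ne_top ENNReal.ofReal_ne_top (min_le_right _ _)
    rw [ENNReal.coe_one, one_mul, edist_dist, Real.dist_eq]
    by_cases hxy : edist x y = ⊤
    · rw [hxy]; exact le_top
    have key : ∀ a b : X, edist a b ≠ ⊤ → (min (edist a x₀) (ENNReal.ofReal r)).toReal ≤
        (min (edist b x₀) (ENNReal.ofReal r)).toReal + (edist a b).toReal := by
      intro a b hab
      rw [← ENNReal.toReal_add (hfin b) hab]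
      refine ENNReal.toReal_mono (ENNReal.add_ne_top.2 ⟨hfin b, hab⟩) ?_
      rw [min_add]
      refine le_min ((min_le_left _ _).trans ?_) ((min_le_right _ _).trans le_self_add)
      rw [add_comm]
      exact edist_triangle a b x₀
    have k1 := key x y hxy
    have k2 := key y x (by rwa [edist_comm])
    rw [edist_comm y x] at k2
    rw [← ENNReal.ofReal_toReal hxy]
    refine ENNReal.ofReal_le_ofReal ?_
    rw [abs_le]
    constructor <;> linarith
  have h2 : LipschitzWith (Real.toNNReal s⁻¹)
      fun x : X => (r - (min (edist x x₀) (ENNReal.ofReal r)).toReal) / s := by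
    intro x y
    refine le_trans (le_of_eq ?_) (mul_le_mul_right ((h1 x y).trans_eq (one_mul _)) _)
    rw [edist_dist, edist_dist, Real.dist_eq, Real.dist_eq, abs_sub_comm, ← ENNReal.ofReal,
      ← ENNReal.ofReal_mul (by positivity)]
    congr 1
    rw [← sub_div, abs_div, abs_of_pos hs, sub_sub_sub_cancel_left]
    ring
  exact (h2.const_max 0).const_min 1

theorem ballCutoff_eq_zero {x₀ x : X} {r s : ℝ} (hr : 0 ≤ r)
    (hx : x ∉ eball x₀ (ENNReal.ofReal r)) : ballCutoff x₀ r s x = 0 := by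
  rw [mem_eball, not_lt] at hx
  rw [ballCutoff, min_eq_right hx, ENNReal.toReal_ofReal hr, sub_self, zero_div, max_self]
  exact min_eq_right zero_le_one

theorem ballCutoff_eq_one {x₀ x : X} {r s : ℝ} (hr : 0 ≤ r) (hs : 0 < s)
    (hx : x ∈ closedEBall x₀ (ENNReal.ofReal r)) (hx' : x ∉ annulus x₀ r s) :
    ballCutoff x₀ r s x = 1 := by
  rw [mem_closedEBall] at hx
  have hfin := ne_top_of_le_ne_top ENNReal.ofReal_ne_top hx
  have h1 : (edist x x₀).toReal < r - s := by
    by_contra hcon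
    exact hx' ((mem_annulus_iff hr).2 ⟨hfin, not_lt.1 hcon,
      ENNReal.toReal_le_of_le_ofReal hr hx⟩)
  rw [ballCutoff, min_eq_left hx]
  refine min_eq_left (le_max_of_le_right ?_)
  rw [one_le_div hs]
  linarith

variable [MeasurableSpace X] [BorelSpace X] {f : X → X} {ν : Measure X} [IsProbabilityMeasure ν]

/-- Balls are almost independent of events in the distant future. -/
theorem DecayOfCorrelations.abs_measureReal_ball_inter_sub_le {Θ : ℕ → ℝ}
    (h : DecayOfCorrelations f ν Θ) (hf : MeasurePreserving f ν ν) (x₀ : X) {r s : ℝ} (hr : 0 ≤ r)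
    (hs : 0 < s) (j : ℕ) {Y : Set X} (hY : MeasurableSet Y) :
    |ν.real (eball x₀ (ENNReal.ofReal r) ∩ f^[j] ⁻¹' Y) -
        ν.real (eball x₀ (ENNReal.ofReal r)) * ν.real Y| ≤
      Θ j * (1 + s⁻¹) + 2 * ν.real (annulus x₀ r s) := by
  set V := eball x₀ (ENNReal.ofReal r) with hV
  have hVm : MeasurableSet V := isOpen_eball.measurableSet
  set φ := ballCutoff x₀ r s with hφ
  have hLip := lipschitzWith_ballCutoff x₀ r hs
  have hφm : Measurable φ := hLip.continuous.measurable
  have hφi : Integrable φ ν := Integrable.of_bound hφm.aestronglyMeasurable 1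
    (Eventually.of_forall fun x => by
      rw [Real.norm_of_nonneg (ballCutoff_nonneg _ _ _ _)]
      exact ballCutoff_le_one _ _ _ _)
  have hΘ0 : ∀ j, 0 ≤ Θ j := fun j => h.1.le_of_tendsto h.2.1 j
  have hYmem : MemLp (Y.indicator fun _ => (1 : ℝ)) ∞ ν := memLp_indicator_const _ hY _
    (Or.inr (measure_ne_top _ _))
  have h1 := h.2.2 φ (Y.indicator fun _ => (1 : ℝ)) 1 (Real.toNNReal s⁻¹)
    (fun x => by
      rw [abs_of_nonneg (ballCutoff_nonneg _ _ _ _)]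
      exact ballCutoff_le_one _ _ _ _) hLip hYmem j
  have hnorm : (eLpNorm (Y.indicator fun _ => (1 : ℝ)) ∞ ν).toReal ≤ 1 := by
    have : eLpNorm (Y.indicator fun _ => (1 : ℝ)) ∞ ν ≤ ENNReal.ofReal 1 := by
      rw [eLpNorm_exponent_top]
      refine eLpNormEssSup_le_of_ae_bound (Eventually.of_forall fun x => ?_)
      by_cases hx : x ∈ Y <;> simp [hx]
    exact ENNReal.toReal_le_of_le_ofReal zero_le_one this
  have h1' : |∫ x, φ x * Y.indicator (fun _ => (1 : ℝ)) (f^[j] x) ∂ν - (∫ x, φ x ∂ν) * ν.real Y| ≤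
      Θ j * (1 + s⁻¹) := by
    rw [integral_indicator_const _ hY, smul_eq_mul, mul_one] at h1
    refine h1.trans ?_
    rw [NNReal.coe_one, Real.coe_toNNReal _ (by positivity)]
    refine mul_le_of_le_one_right ?_ hnorm
    have := hΘ0 j
    positivity
  have hprod : (fun x => φ x * Y.indicator (fun _ => (1 : ℝ)) (f^[j] x)) =
      (f^[j] ⁻¹' Y).indicator φ := by
    funext x
    by_cases hx : f^[j] x ∈ Y <;> simp [indicator, hx]
  have hjm : MeasurableSet (f^[j] ⁻¹' Y) := (hf.measurable.iterate j) hY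
  -- Indicator and cutoff differ by at most one, and only on the annulus. This is used for `Z =
  -- f^[j] ⁻¹' Y` and for the whole space, hence the factor `2`.
  have happrox : ∀ Z, MeasurableSet Z →
      |ν.real (V ∩ Z) - ∫ x, Z.indicator φ x ∂ν| ≤ ν.real (annulus x₀ r s) := by
    intro Z hZ
    have e1 : ν.real (V ∩ Z) = ∫ x, (V ∩ Z).indicator (fun _ => (1 : ℝ)) x ∂ν := by
      rw [integral_indicator_const _ (hVm.inter hZ), smul_eq_mul, mul_one]
    have e2 : ν.real (annulus x₀ r s) =
        ∫ x, (annulus x₀ r s).indicator (fun _ => (1 : ℝ)) x ∂ν := by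
      rw [integral_indicator_const _ (measurableSet_annulus _ _ _), smul_eq_mul, mul_one]
    have i1 : Integrable ((V ∩ Z).indicator (fun _ => (1 : ℝ))) ν :=
      (integrable_const _).indicator (hVm.inter hZ)
    have i2 : Integrable ((annulus x₀ r s).indicator (fun _ => (1 : ℝ))) ν :=
      (integrable_const _).indicator (measurableSet_annulus _ _ _)
    have i3 : Integrable (Z.indicator φ) ν := hφi.indicator hZ
    rw [e1, e2, ← integral_sub i1 i3]
    refine abs_integral_le_integral_abs.trans (integral_mono (i1.sub i3).abs i2 fun x => ?_)
    change |(V ∩ Z).indicator (fun _ => (1 : ℝ)) x - Z.indicator φ x| ≤ _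
    have n0 : 0 ≤ φ x := ballCutoff_nonneg x₀ r s x
    have n1 : φ x ≤ 1 := ballCutoff_le_one x₀ r s x
    have hA0 : 0 ≤ (annulus x₀ r s).indicator (fun _ => (1 : ℝ)) x :=
      indicator_nonneg (fun _ _ => zero_le_one) x
    by_cases hxZ : x ∈ Z
    · rw [indicator_of_mem hxZ]
      by_cases hxV : x ∈ V
      · rw [indicator_of_mem (show x ∈ V ∩ Z from ⟨hxV, hxZ⟩)]
        by_cases hxA : x ∈ annulus x₀ r s
        · rw [indicator_of_mem hxA, abs_le]
          constructor <;> linarith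
        · have : φ x = 1 := ballCutoff_eq_one hr hs (eball_subset_closedEBall hxV) hxA
          rwa [this, sub_self, abs_zero]
      · have : φ x = 0 := ballCutoff_eq_zero hr hxV
        rwa [this, indicator_of_notMem (fun h => hxV h.1), sub_zero, abs_zero]
    · rwa [indicator_of_notMem hxZ, indicator_of_notMem (fun h => hxZ h.2), sub_zero, abs_zero]
  have a1 := happrox _ hjm
  have a2 := happrox univ MeasurableSet.univ
  rw [inter_univ, indicator_univ] at a2
  rw [hprod] at h1'
  have hY0 : 0 ≤ ν.real Y := measureReal_nonneg
  have hY1 : ν.real Y ≤ 1 := measureReal_le_one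
  have a3 : |(∫ x, φ x ∂ν) * ν.real Y - ν.real V * ν.real Y| ≤ ν.real (annulus x₀ r s) := by
    rw [← sub_mul, abs_mul, abs_of_nonneg hY0, abs_sub_comm]
    exact (mul_le_of_le_one_right (abs_nonneg _) hY1).trans a2
  rw [abs_le] at a1 h1' a3 ⊢
  constructor <;> linarith [a1.1, a1.2, h1'.1, h1'.2, a3.1, a3.2]

end Mixing

/-! ### Translation of thresholds into radii. -/

section Thresholds

open Set Metric

variable {X : Type*} [EMetricSpace X]

theorem threshold_le_logDistObservable_iff {x₀ x : X} {a : ℝ} :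
    (a : EReal) ≤ logDistObservable x₀ x ↔ edist x x₀ ≤ ENNReal.ofReal (Real.exp (-a)) := by
  rw [logDistObservable, EReal.le_neg, ← EReal.coe_neg, ← EReal.exp_coe,
    ← ENNReal.log_le_log_iff, EReal.log_exp]

theorem setOf_threshold_le_eq (x₀ : X) (a : ℝ) :
    {x | (a : EReal) ≤ logDistObservable x₀ x} =
      closedEBall x₀ (ENNReal.ofReal (Real.exp (-a))) := by
  ext x
  exact threshold_le_logDistObservable_iff

/-- The ball is open here and closed for `{φ ≥ u_n}`: both inequalities are weak, so the sphere
belongs to both events. -/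
theorem logDistObservable_le_iff {x₀ x : X} {a : ℝ} :
    logDistObservable x₀ x ≤ (a : EReal) ↔ x ∉ eball x₀ (ENNReal.ofReal (Real.exp (-a))) := by
  rw [logDistObservable, EReal.neg_le, ← EReal.coe_neg, mem_eball, not_lt,
    ← EReal.exp_coe, ← ENNReal.log_le_log_iff, EReal.log_exp]

theorem setOf_maxProcess_le_eq (f : X → X) (x₀ : X) (n : ℕ) (a : ℝ) :
    {x | maxProcess f (logDistObservable x₀) n x ≤ (a : EReal)} =
      avoidSet f (eball x₀ (ENNReal.ofReal (Real.exp (-a)))) n := by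
  ext x
  simp only [maxProcess, mem_ofPred_eq, Finset.sup_le_iff, Finset.mem_range, avoidSet,
    logDistObservable_le_iff]

/-- The normalization behind `u_n`: it gives the exceedance ball a volume of order `1 / n`, so `n`
trials see it a bounded number of times on average. -/
theorem exp_neg_threshold_pow {d n : ℕ} (hd : 1 ≤ d) (hn : 1 ≤ n) (u : ℝ) :
    Real.exp (-threshold d n u) ^ d = Real.exp (-u) / n := by
  have hd0 : (d : ℝ) ≠ 0 := by positivity
  have hn0 : (0 : ℝ) < n := by positivity
  rw [← Real.exp_nat_mul, threshold]
  have : (d : ℝ) * -(u / d + (d : ℝ)⁻¹ * Real.log n) = -u - Real.log n := by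
    field_simp
    ring
  rw [this, Real.exp_sub, Real.exp_log hn0]

end Thresholds

/-! ### Elementary comparison of powers with exponentials. -/

section ExponentialApproximation

/-- Follows from `-x - 2 x² ≤ log (1 - x) ≤ -x` at `x = τ / N ≤ 1 / 2`. Used with `N = n` for the
avoidance probability and with `N = √n` for `G_{√n}`. -/
theorem abs_one_sub_div_rpow_sub_exp_le {τ N : ℝ} (hτ : 0 ≤ τ) (hN : 0 < N) (hτN : 2 * τ ≤ N) :
    |(1 - τ / N) ^ N - Real.exp (-τ)| ≤ 2 * τ ^ 2 / N := by
  set x := τ / N with hx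
  have hx0 : 0 ≤ x := by positivity
  have hx1 : x ≤ 1 / 2 := by rw [hx, div_le_iff₀ hN]; linarith
  have hτx : τ = N * x := by rw [hx]; field_simp
  have h1 : Real.log (1 - x) ≤ -x := by
    have := Real.log_le_sub_one_of_pos (show 0 < 1 - x by linarith)
    linarith
  have h2 : -x - 2 * x ^ 2 ≤ Real.log (1 - x) := by
    have := Real.one_sub_inv_le_log_of_pos (show 0 < 1 - x by linarith)
    refine le_trans ?_ this
    rw [← sub_nonneg]
    have : 1 - (1 - x)⁻¹ - (-x - 2 * x ^ 2) = x ^ 2 * (1 - 2 * x) / (1 - x) := by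
      have : (1 : ℝ) - x ≠ 0 := by linarith
      field_simp
      ring
    rw [this]
    apply div_nonneg _ (by linarith)
    exact mul_nonneg (sq_nonneg x) (by linarith)
  rw [Real.rpow_def_of_pos (by linarith), mul_comm]
  set e := N * Real.log (1 - x) with he
  have e1 : e ≤ -τ := by rw [hτx, he]; nlinarith
  have e2 : -τ - 2 * τ ^ 2 / N ≤ e := by
    have : -τ - 2 * τ ^ 2 / N = N * (-x - 2 * x ^ 2) := by
      rw [hτx]
      field_simp
    rw [this, he]
    gcongr
  have h3 : Real.exp e ≤ Real.exp (-τ) := Real.exp_le_exp.2 e1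
  rw [abs_of_nonpos (by linarith), neg_sub]
  have h4 : Real.exp e = Real.exp (-τ) * Real.exp (e + τ) := by
    rw [← Real.exp_add]
    congr 1
    ring
  have h5 : 1 + (e + τ) ≤ Real.exp (e + τ) := by linarith [Real.add_one_le_exp (e + τ)]
  have h6 : Real.exp (-τ) ≤ 1 := Real.exp_le_one_iff.2 (by linarith)
  have h7 : 0 < Real.exp (-τ) := Real.exp_pos _
  rw [h4]
  nlinarith

theorem abs_pow_sub_pow_le_mul {a b : ℝ} (ha : 0 ≤ a) (ha1 : a ≤ 1) (hb : 0 ≤ b) (hb1 : b ≤ 1)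
    (n : ℕ) : |a ^ n - b ^ n| ≤ n * |a - b| := by
  induction n with
  | zero => simp
  | succ n ih =>
    have : a ^ (n + 1) - b ^ (n + 1) = a * (a ^ n - b ^ n) + (a - b) * b ^ n := by ring
    rw [this]
    refine (abs_add_le _ _).trans ?_
    rw [abs_mul, abs_mul, abs_of_nonneg ha, abs_of_nonneg (pow_nonneg hb n)]
    have h1 : a * |a ^ n - b ^ n| ≤ |a ^ n - b ^ n| := mul_le_of_le_one_left (abs_nonneg _) ha1
    have h2 : |a - b| * b ^ n ≤ |a - b| :=
      mul_le_of_le_one_right (abs_nonneg _) (pow_le_one₀ hb hb1)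
    push_cast
    linarith

end ExponentialApproximation

/-! ### Error estimate for fixed `n`. -/

section ErrorBound

open Set Metric

variable {X : Type*} [EMetricSpace X] [MeasurableSpace X] [BorelSpace X] {f : X → X}
  {ν : Measure X} [IsProbabilityMeasure ν] {d : ℕ}

/-- The basic error estimate, in terms of the probability of short returns, the measure of a thin
annulus, and the correlation decay. -/
theorem abs_maxProb_sub_sqrtApprox_le {Θ : ℕ → ℝ} (h : DecayOfCorrelations f ν Θ)
    (hf : MeasurePreserving f ν ν) (x₀ : X) {n : ℕ} (hn : 1 ≤ n) {u r s b : ℝ}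
    (hr : r = Real.exp (-threshold d n u)) (hs : 0 < s) (t : ℕ)
    (hb : ν.real (eball x₀ (ENNReal.ofReal r) ∩
      {x | ∃ j, 1 ≤ j ∧ j ≤ t ∧ f^[j] x ∈ eball x₀ (ENNReal.ofReal r)}) ≤ b)
    (hτ : 2 * (n * ν.real (closedEBall x₀ (ENNReal.ofReal r))) ≤ √n) :
    |maxProb d f ν x₀ n u - sqrtApprox d ν x₀ n u| ≤
      n * (b + (Θ (t + 1) * (1 + s⁻¹) + 2 * ν.real (annulus x₀ r s)) +
        t * ν.real (closedEBall x₀ (ENNReal.ofReal r)) ^ 2) +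
      n * ν.real (annulus x₀ r s) +
      4 * (n * ν.real (closedEBall x₀ (ENNReal.ofReal r))) ^ 2 / √n := by
  have hr0 : 0 < r := hr ▸ Real.exp_pos _
  have hn0 : (0 : ℝ) < n := by positivity
  have hn1 : (1 : ℝ) ≤ n := by exact_mod_cast hn
  have hsq : √(n : ℝ) ≤ n := by
    rw [Real.sqrt_le_iff]
    constructor <;> nlinarith
  have hsq0 : 0 < √(n : ℝ) := Real.sqrt_pos.2 hn0
  set V := eball x₀ (ENNReal.ofReal r) with hV
  set U := closedEBall x₀ (ENNReal.ofReal r) with hU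
  have hVm : MeasurableSet V := isOpen_eball.measurableSet
  have hVU : ν.real V ≤ ν.real U := measureReal_mono eball_subset_closedEBall
  -- `τ_n` uses the closed ball and avoidance the open one; the sphere between them lies in the
  -- annulus.
  have hUV : ν.real U ≤ ν.real V + ν.real (annulus x₀ r s) := by
    refine (measureReal_mono (fun y hy => ?_)).trans (measureReal_union_le _ _)
    by_cases hyV : y ∈ V
    · exact Or.inl hyV
    · rw [hV, mem_eball, not_lt] at hyV
      exact Or.inr ⟨(ENNReal.ofReal_le_ofReal (by linarith)).trans hyV, hy⟩
  have hV0 : 0 ≤ ν.real V := measureReal_nonneg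
  have hU1 : ν.real U ≤ 1 := measureReal_le_one
  set τ := n * ν.real U with hτdef
  have hτ0 : 0 ≤ τ := by positivity
  have hmax : maxProb d f ν x₀ n u = ν.real (avoidSet f V n) := by
    rw [maxProb, setOf_maxProcess_le_eq, hV, hr]
  have htau : tau d ν x₀ n u = τ := by
    rw [tau, setOf_threshold_le_eq, hτdef, hU, hr]
  have e1 := abs_avoidSet_sub_pow_le hf hVm t hb
    (fun Y hY => h.abs_measureReal_ball_inter_sub_le hf x₀ hr0.le hs (t + 1) hY) n
  have e2 : |(1 - ν.real V) ^ n - (1 - ν.real U) ^ n| ≤ n * ν.real (annulus x₀ r s) := by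
    refine (abs_pow_sub_pow_le_mul (by linarith) (by linarith) (by linarith)
      (by linarith) n).trans ?_
    gcongr
    rw [abs_le]
    constructor <;> linarith
  have e3 : |(1 - ν.real U) ^ n - Real.exp (-τ)| ≤ 2 * τ ^ 2 / √n := by
    have h1 := abs_one_sub_div_rpow_sub_exp_le hτ0 hn0 (hτ.trans hsq)
    rw [Real.rpow_natCast, hτdef, mul_div_cancel_left₀ _ hn0.ne', ← hτdef] at h1
    refine h1.trans ?_
    gcongr
  have e4 : |sqrtApprox d ν x₀ n u - Real.exp (-τ)| ≤ 2 * τ ^ 2 / √n := by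
    rw [sqrtApprox, htau]
    exact abs_one_sub_div_rpow_sub_exp_le hτ0 hsq0 hτ
  have e5 : (t : ℝ) * ν.real V ^ 2 ≤ t * ν.real U ^ 2 := by gcongr
  have e6 := mul_le_mul_of_nonneg_left e5 hn0.le
  have e7 : 4 * τ ^ 2 / √(n : ℝ) = 2 * τ ^ 2 / √(n : ℝ) + 2 * τ ^ 2 / √(n : ℝ) := by ring
  rw [hmax, e7]
  rw [mul_add] at e1 ⊢
  rw [abs_le] at e1 e2 e3 e4 ⊢
  constructor <;> linarith [e1.1, e1.2, e2.1, e2.2, e3.1, e3.2, e4.1, e4.2]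

omit [MeasurableSpace X] [BorelSpace X] in
/-- Two visits to a small ball in a short time are a short recurrence. -/
theorem eball_inter_return_subset_recurrenceSet {x₀ : X} {r : ℝ} {N t : ℕ} {g : ℕ → ℝ}
    (hd : 1 ≤ d) (hr : 0 ≤ r) (hrN : (2 * r) ^ d * N ≤ 1) (hN : 1 ≤ N) (ht : (t : ℝ) ≤ g N) :
    eball x₀ (ENNReal.ofReal r) ∩
      {x | ∃ j, 1 ≤ j ∧ j ≤ t ∧ f^[j] x ∈ eball x₀ (ENNReal.ofReal r)} ⊆
    closedEBall x₀ (ENNReal.ofReal r) ∩ recurrenceSet d f g N := by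
  rintro x ⟨hx, j, hj1, hjt, hj⟩
  refine ⟨eball_subset_closedEBall hx, j, hj1, ?_, ?_⟩
  · exact le_trans (by exact_mod_cast hjt) ht
  · have hN0 : (0 : ℝ) < N := by positivity
    have h1 : 2 * r ≤ (N : ℝ) ^ (-(1 / (d : ℝ))) := by
      rw [Real.rpow_neg hN0.le, ← Real.inv_rpow hN0.le, one_div]
      rw [Real.le_rpow_inv_iff_of_pos (by positivity) (by positivity) (by positivity),
        Real.rpow_natCast, ← one_div, le_div_iff₀ hN0]
      exact hrN
    calc edist x (f^[j] x) ≤ edist x x₀ + edist (f^[j] x) x₀ := edist_triangle_right _ _ _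
      _ ≤ ENNReal.ofReal r + ENNReal.ofReal r :=
          add_le_add (le_of_lt (mem_eball.1 hx)) (le_of_lt (mem_eball.1 hj))
      _ = ENNReal.ofReal (2 * r) := by rw [← ENNReal.ofReal_add hr hr, two_mul]
      _ ≤ _ := ENNReal.ofReal_le_ofReal h1

end ErrorBound

/-! ### Subsequence of scales, and decay along logarithmic gaps. -/

section Scales

theorem tendsto_log_natCast_atTop : Tendsto (fun n : ℕ => Real.log n) atTop atTop :=
  Real.tendsto_log_atTop.comp tendsto_natCast_atTop_atTop

theorem log_two_pow_pow (k a : ℕ) :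
    Real.log ((2 ^ ((k + 1) ^ a) : ℕ) : ℝ) = ((k : ℝ) + 1) ^ a * Real.log 2 := by
  push_cast
  rw [Real.log_pow]
  push_cast
  rfl

/-- Every large `n` is comparable, on the logarithmic scale, to some `2 ^ (k + 1) ^ a` well
below `n`. -/
theorem eventually_exists_scale {a : ℕ} (ha : 1 ≤ a) (B : ℝ) :
    ∃ c : ℝ, 0 < c ∧ ∀ k₀ : ℕ, ∀ᶠ n : ℕ in atTop, ∃ k ≥ k₀,
      B * 2 ^ ((k + 1) ^ a) ≤ (n : ℝ) ∧ c * Real.log n ≤ ((k : ℝ) + 1) ^ a ∧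
        ((k : ℝ) + 1) ^ a * Real.log 2 ≤ Real.log n := by
  have hl2 : 0 < Real.log 2 := Real.log_pos one_lt_two
  have ha0 : (a : ℝ) ≠ 0 := by positivity
  -- `k + 1` is the integer part of `z = (log n / (2 log 2)) ^ (1/a)`, so `2 ^ (k + 1) ^ a ≤ √n` and
  -- a second `√n` absorbs `B`. The factor `2 ^ a` comes from `z ≤ 2 (k + 1)`.
  refine ⟨1 / (2 ^ a * (2 * Real.log 2)), by positivity, fun k₀ => ?_⟩
  have hy : Tendsto (fun n : ℕ => (Real.log n / (2 * Real.log 2)) ^ (1 / (a : ℝ))) atTop atTop :=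
    (tendsto_rpow_atTop (by positivity)).comp
      (tendsto_log_natCast_atTop.atTop_div_const (by positivity))
  filter_upwards [hy.eventually_ge_atTop ((k₀ : ℝ) + 2), eventually_ge_atTop 1,
    tendsto_natCast_atTop_atTop.eventually_ge_atTop (B ^ 2)] with n hn hn1 hnB
  have hn0 : (0 : ℝ) < n := by positivity
  set y := Real.log n / (2 * Real.log 2) with hydef
  have hy0 : 0 ≤ y := div_nonneg (Real.log_natCast_nonneg n) (by positivity)
  set z := y ^ (1 / (a : ℝ)) with hz
  have hz0 : 0 ≤ z := by positivity
  have hza : z ^ a = y := by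
    rw [hz, ← Real.rpow_natCast, ← Real.rpow_mul hy0, one_div_mul_cancel ha0, Real.rpow_one]
  obtain ⟨k, hk⟩ : ∃ k, ⌊z⌋₊ = k + 1 := by
    refine Nat.exists_eq_succ_of_ne_zero (Nat.floor_pos.2 ?_).ne'
    have : (0 : ℝ) ≤ k₀ := Nat.cast_nonneg _
    linarith
  have h1 : (k : ℝ) + 1 ≤ z := by
    have := Nat.floor_le hz0
    rw [hk] at this
    exact_mod_cast this
  have h2 : z < (k : ℝ) + 1 + 1 := by
    have := Nat.lt_floor_add_one z
    rw [hk] at this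
    exact_mod_cast this
  have h3 : ((k : ℝ) + 1) ^ a ≤ y := hza ▸ pow_le_pow_left₀ (by positivity) h1 a
  have h4 : y * Real.log 2 = Real.log n / 2 := by rw [hydef]; field_simp
  refine ⟨k, ?_, ?_, ?_, ?_⟩
  · have : (k₀ : ℝ) ≤ k := by linarith
    exact_mod_cast this
  · have e1 : (2 : ℝ) ^ ((k + 1) ^ a) = Real.exp (((k : ℝ) + 1) ^ a * Real.log 2) := by
      rw [mul_comm, ← Real.rpow_def_of_pos two_pos, ← Real.rpow_natCast]
      push_cast
      rfl
    have e2 : (2 : ℝ) ^ ((k + 1) ^ a) ≤ √n := by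
      rw [e1, ← Real.exp_log (Real.sqrt_pos.2 hn0), Real.log_sqrt hn0.le, ← h4]
      exact Real.exp_le_exp.2 (by gcongr)
    calc B * 2 ^ ((k + 1) ^ a) ≤ √n * √n :=
          mul_le_mul (Real.le_sqrt_of_sq_le hnB) e2 (by positivity) (Real.sqrt_nonneg _)
      _ = n := Real.mul_self_sqrt hn0.le
  · have : y ≤ 2 ^ a * ((k : ℝ) + 1) ^ a := by
      rw [← hza, ← mul_pow]
      exact pow_le_pow_left₀ hz0 (by have : (0 : ℝ) ≤ k := Nat.cast_nonneg _; linarith) a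
    rw [hydef, div_le_iff₀ (by positivity)] at this
    rw [one_div_mul_eq_div, div_le_iff₀ (by positivity)]
    linarith
  · have := mul_le_mul_of_nonneg_right h3 hl2.le
    have h5 : 0 ≤ Real.log n := Real.log_natCast_nonneg n
    linarith

/-- Stretched exponential decay at times `≥ c (log n) ^ γ` beats every power of `n`. -/
theorem eventually_le_one_div_pow_of_isBigO {Θ : ℕ → ℝ} {θ₀ β γ c : ℝ} (h0 : 0 < θ₀) (h1 : θ₀ < 1)
    (hβ : 0 < β) (hγ : 0 < γ) (hγβ : 1 < γ * β) (hc : 0 < c)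
    (hΘ : Θ =O[atTop] fun n : ℕ => θ₀ ^ ((n : ℝ) ^ β)) (Q : ℕ) :
    ∀ᶠ n : ℕ in atTop, ∀ t : ℕ, c * Real.log n ^ γ ≤ t → Θ t ≤ 1 / (n : ℝ) ^ Q := by
  obtain ⟨C, hC, hb⟩ := hΘ.exists_pos
  obtain ⟨T, hT⟩ := eventually_atTop.1 hb.bound
  have hη : 0 < -Real.log θ₀ := neg_pos.2 (Real.log_neg h0 h1)
  set η := -Real.log θ₀ with hηdef
  have hL := tendsto_log_natCast_atTop
  have hLγ : Tendsto (fun n : ℕ => c * Real.log n ^ γ) atTop atTop :=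
    ((tendsto_rpow_atTop hγ).comp hL).const_mul_atTop hc
  have hLγβ : Tendsto (fun n : ℕ => η * c ^ β * Real.log n ^ (γ * β - 1)) atTop atTop :=
    ((tendsto_rpow_atTop (by linarith)).comp hL).const_mul_atTop (by positivity)
  filter_upwards [hLγ.eventually_ge_atTop (T : ℝ), hLγβ.eventually_ge_atTop ((Q : ℝ) + 1),
    hL.eventually_ge_atTop (Real.log C), hL.eventually_ge_atTop 1, eventually_ge_atTop 1]
    with n hn1 hn2 hn3 hn4 hn5 t ht
  have hn0 : (0 : ℝ) < n := by positivity
  have hTt : T ≤ t := by exact_mod_cast hn1.trans ht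
  have hL0 : 0 < Real.log n := by linarith
  have e1 : Θ t ≤ C * θ₀ ^ ((t : ℝ) ^ β) := by
    have := hT t hTt
    rw [Real.norm_of_nonneg (by positivity : (0 : ℝ) ≤ θ₀ ^ ((t : ℝ) ^ β))] at this
    exact (le_abs_self _).trans this
  -- Here `γ β > 1` matters: the exponent of the decay exceeds `log n` by a factor tending to
  -- infinity.
  have e2 : η * c ^ β * Real.log n ^ (γ * β - 1) * Real.log n ≤ η * (t : ℝ) ^ β := by
    have : (c * Real.log n ^ γ) ^ β ≤ (t : ℝ) ^ β := by gcongr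
    rw [Real.mul_rpow hc.le (by positivity), ← Real.rpow_mul hL0.le] at this
    rw [mul_assoc, ← Real.rpow_add_one hL0.ne', sub_add_cancel, mul_assoc]
    gcongr
  have e3 : ((Q : ℝ) + 1) * Real.log n ≤ η * (t : ℝ) ^ β :=
    (mul_le_mul_of_nonneg_right hn2 hL0.le).trans e2
  calc Θ t ≤ C * θ₀ ^ ((t : ℝ) ^ β) := e1
    _ = Real.exp (Real.log C + -(η * (t : ℝ) ^ β)) := by
        rw [Real.exp_add, Real.exp_log hC, Real.rpow_def_of_pos h0, hηdef]
        congr 2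
        ring
    _ ≤ Real.exp (-(Q * Real.log n)) := Real.exp_le_exp.2 (by linarith)
    _ = 1 / (n : ℝ) ^ Q := by
        rw [Real.exp_neg, Real.exp_nat_mul, Real.exp_log hn0, one_div]

theorem eventually_log_rpow_le_sqrt (γ : ℝ) : ∀ᶠ n : ℕ in atTop, Real.log n ^ γ ≤ √(n : ℝ) := by
  have h := (isLittleO_log_rpow_rpow_atTop γ (show (0 : ℝ) < 1 / 2 by norm_num)).bound one_pos
  filter_upwards [tendsto_natCast_atTop_atTop.eventually h] with n hn
  rw [one_mul, Real.norm_of_nonneg (by positivity : (0 : ℝ) ≤ (n : ℝ) ^ (1 / 2 : ℝ)),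
    ← Real.sqrt_eq_rpow] at hn
  exact (le_abs_self _).trans hn

end Scales

/-! ### Choice of parameters and the resulting error. -/

section ErrorAsymptotics

open Set Metric

variable {X : Type*} [EMetricSpace X] [MeasurableSpace X] [BorelSpace X] {f : X → X}
  {ν : Measure X} [IsProbabilityMeasure ν] {d : ℕ}

theorem exp_neg_threshold_pow_le {d n : ℕ} (hd : 1 ≤ d) (hn : 1 ≤ n) {u R : ℝ} (hu : |u| ≤ R) :
    Real.exp (-threshold d n u) ^ d ≤ Real.exp R / n ∧
      Real.exp (-R) / n ≤ Real.exp (-threshold d n u) ^ d := by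
  rw [exp_neg_threshold_pow hd hn]
  obtain ⟨h1, h2⟩ := abs_le.1 hu
  exact ⟨by gcongr; linarith, by gcongr⟩

/-- Small powers force small radii. -/
theorem eventually_exp_neg_threshold_le (hd : 1 ≤ d) (R : ℝ) {r₀ : ℝ} (hr₀ : 0 < r₀) :
    ∀ᶠ n : ℕ in atTop, ∀ u : ℝ, |u| ≤ R → Real.exp (-threshold d n u) ≤ r₀ := by
  have h : Tendsto (fun n : ℕ => Real.exp R / n) atTop (𝓝 0) :=
    tendsto_const_div_atTop_nhds_zero_nat _
  filter_upwards [h.eventually_le_const (show 0 < r₀ ^ d by positivity), eventually_ge_atTop 1]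
    with n hn hn1 u hu
  refine le_of_pow_le_pow_left₀ (by omega : d ≠ 0) hr₀.le ?_
  exact (exp_neg_threshold_pow_le hd hn1 hu).1.trans hn

/-- With `θ ^ q < 1 / 4`, the depth `j = q ⌊log₂ n⌋` makes annuli of width `r / 4 ^ j` have measure
`O(n⁻²)`, while the inverse relative width `4 ^ j` grows only polynomially. -/
theorem exists_pow_mul_log_le {θ : ℝ} (h0 : 0 < θ) (h1 : θ < 1) :
    ∃ q : ℕ, ∀ n : ℕ, 1 ≤ n → θ ^ (q * Nat.log 2 n) ≤ 4 / (n : ℝ) ^ 2 ∧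
      (4 : ℝ) ^ (q * Nat.log 2 n) ≤ (n : ℝ) ^ (2 * q) := by
  obtain ⟨q, hq⟩ := exists_pow_lt_of_lt_one (show (0 : ℝ) < 1 / 4 by norm_num) h1
  refine ⟨q, fun n hn => ?_⟩
  have hn0 : (0 : ℝ) < n := by positivity
  constructor
  · have h2 : (n : ℝ) ≤ 2 * 2 ^ Nat.log 2 n := by
      have := (Nat.lt_pow_succ_log_self one_lt_two n).le
      rw [pow_succ, mul_comm] at this
      exact_mod_cast this
    rw [pow_mul]
    calc (θ ^ q) ^ Nat.log 2 n ≤ (1 / 4) ^ Nat.log 2 n := by gcongr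
      _ ≤ 4 / (n : ℝ) ^ 2 := by
        rw [one_div, inv_pow, ← one_div, div_le_div_iff₀ (by positivity) (by positivity)]
        have h4 : (4 : ℝ) ^ Nat.log 2 n = (2 ^ Nat.log 2 n) ^ 2 := by
          rw [← pow_mul, mul_comm, pow_mul]
          norm_num
        rw [h4]
        nlinarith
  · have h2 : (2 : ℝ) ^ Nat.log 2 n ≤ n := by
      exact_mod_cast Nat.pow_log_le_self 2 (by omega)
    have h4 : (4 : ℝ) ^ (q * Nat.log 2 n) = (2 ^ Nat.log 2 n) ^ (2 * q) := by
      rw [show (4 : ℝ) = 2 ^ 2 by norm_num, ← pow_mul, ← pow_mul]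
      congr 1
      ring
    rw [h4]
    gcongr

theorem eventually_bounds_of_isEquivalent_log_rpow {g : ℕ → ℝ} {γ : ℝ}
    (hg : g ~[atTop] fun n : ℕ => Real.log n ^ γ) :
    ∀ᶠ n : ℕ in atTop, 1 / 2 * Real.log n ^ γ ≤ g n ∧ g n ≤ 2 * Real.log n ^ γ := by
  filter_upwards [hg.isLittleO.bound (show (0 : ℝ) < 1 / 2 by norm_num)] with n hn
  have h0 : 0 ≤ Real.log n ^ γ := Real.rpow_nonneg (Real.log_natCast_nonneg n) _
  rw [Pi.sub_apply, Real.norm_eq_abs, Real.norm_of_nonneg h0, abs_le] at hn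
  constructor <;> linarith [hn.1, hn.2]

/-- Bookkeeping, with `x = n`, `E = e ^ R`, `A` and `B` the annulus and recurrence constants, `M` a
bound for `τ_n`, and `l` the relative density `lam k`. -/
theorem error_terms_le {x E A B M l : ℝ} (hx : 1 ≤ x) (hE : 0 ≤ E) (hA : 0 ≤ A) (hB : 0 ≤ B)
    (hl : 0 ≤ l) :
    x * (B * l * (E / x) + ((1 + E) / x ^ 2 + 2 * (4 * A / x ^ 2)) + 2 * √x * (M / x) ^ 2) +
        x * (4 * A / x ^ 2) + 4 * M ^ 2 / √x ≤
      (B * E + (1 + E + 12 * A + 6 * M ^ 2)) * (l + 1 / √x) := by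
  have hx0 : 0 < x := by linarith
  have hw0 : 0 < √x := Real.sqrt_pos.2 hx0
  have hww : √x * √x = x := Real.mul_self_sqrt hx0.le
  have hinv : 1 / x ≤ 1 / √x :=
    one_div_le_one_div_of_le hw0 (Real.sqrt_le_iff.2 ⟨hx0.le, by nlinarith⟩)
  calc _ = B * E * l + (1 + E + 12 * A) * (1 / x) + 6 * M ^ 2 * (1 / √x) := by
        have e : √x / x = 1 / √x := by
          rw [div_eq_div_iff hx0.ne' hw0.ne', hww, one_mul]
        have e' : x * (2 * √x * (M / x) ^ 2) = 2 * M ^ 2 * (√x / x) := by field_simp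
        rw [mul_add, e', e]
        field_simp
        ring
    _ ≤ B * E * l + (1 + E + 12 * A) * (1 / √x) + 6 * M ^ 2 * (1 / √x) := by gcongr
    _ ≤ _ := by
        have hw : 0 ≤ 1 / √x := by positivity
        have t1 : 0 ≤ (1 + E + 12 * A + 6 * M ^ 2) * l := by positivity
        have t2 : 0 ≤ B * E * (1 / √x) := by positivity
        linarith

set_option maxHeartbeats 1000000 in
/-- At a point where balls are regular, annuli are thin, and short returns are unlikely, the
extreme value law is approximated with an explicit error. -/
theorem exists_eventually_abs_maxProb_sub_sqrtApprox_le {Θ : ℕ → ℝ}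
    (hmix : DecayOfCorrelations f ν Θ) (hf : MeasurePreserving f ν ν) (hd : 1 ≤ d) {θ₀ β γ : ℝ}
    (h0 : 0 < θ₀) (h1 : θ₀ < 1) (hβ : 0 < β) (hγ : 0 < γ) (hγβ : 1 < γ * β)
    (hΘ : Θ =O[atTop] fun n : ℕ => θ₀ ^ ((n : ℝ) ^ β)) {g : ℕ → ℝ}
    (hg : g ~[atTop] fun n : ℕ => Real.log n ^ γ) {a : ℕ} (ha : 1 ≤ a) {lam : ℕ → ℝ}
    (hlam : ∀ k, 0 ≤ lam k) {x₀ : X}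
    (hdens : ∃ C : ℝ, 0 < C ∧ Tendsto
      (fun r : ℝ => ν.real (closedEBall x₀ (ENNReal.ofReal r)) / r ^ d) (𝓝[>] 0) (𝓝 C))
    (hann : ∃ θ C r₀ : ℝ, 0 < θ ∧ θ < 1 ∧ 0 < C ∧ 0 < r₀ ∧ ∀ r : ℝ, 0 < r → r ≤ r₀ →
      ∀ j : ℕ, ν.real (annulus x₀ r (r / 4 ^ j)) ≤ C * θ ^ j)
    (hrec : ∃ C r₀ : ℝ, 0 < C ∧ 0 < r₀ ∧ ∀ᶠ k : ℕ in atTop, ∀ r : ℝ, 0 < r → r ≤ r₀ →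
      ν.real (closedEBall x₀ (ENNReal.ofReal r) ∩ recurrenceSet d f g (2 ^ ((k + 1) ^ a))) ≤
        C * lam k * r ^ d) (R : ℝ) :
    ∃ C c : ℝ, 0 < C ∧ 0 < c ∧ ∀ᶠ n : ℕ in atTop, ∃ k : ℕ,
      c * Real.log n ≤ ((k : ℝ) + 1) ^ a ∧ ((k : ℝ) + 1) ^ a * Real.log 2 ≤ Real.log n ∧
      ∀ u : ℝ, |u| ≤ R →
        |maxProb d f ν x₀ n u - sqrtApprox d ν x₀ n u| ≤ C * (lam k + 1 / √(n : ℝ)) := by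
  obtain ⟨C₀, hC₀, hdens⟩ := hdens
  obtain ⟨θ, C₂, r₂, hθ0, hθ1, hC₂, hr₂, hann⟩ := hann
  obtain ⟨C₃, r₃, hC₃, hr₃, hrec⟩ := hrec
  have hl2 : 0 < Real.log 2 := Real.log_pos one_lt_two
  obtain ⟨r₁, hr₁, hdens⟩ : ∃ r₁ > 0, ∀ r ∈ Ioc (0 : ℝ) r₁,
      ν.real (closedEBall x₀ (ENNReal.ofReal r)) ≤ 2 * C₀ * r ^ d := by
    have h := hdens.eventually_le_const (show C₀ < 2 * C₀ by linarith)
    obtain ⟨ε, hε, hsub⟩ := mem_nhdsGT_iff_exists_Ioc_subset.1 h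
    refine ⟨ε, hε, fun r hr => ?_⟩
    have := hsub hr
    rwa [mem_ofPred_eq, div_le_iff₀ (pow_pos hr.1 d)] at this
  obtain ⟨q, hq⟩ := exists_pow_mul_log_le hθ0 hθ1
  -- The constant ensures `(2 r) ^ d N ≤ 1` for the scale `N`, since `r ^ d ≤ e ^ R / n`.
  obtain ⟨c, hc, hscale⟩ := eventually_exists_scale ha (2 ^ d * Real.exp R)
  have hN : Tendsto (fun k : ℕ => 2 ^ ((k + 1) ^ a)) atTop (atTop : Filter ℕ) := by
    refine (tendsto_pow_atTop_atTop_of_one_lt one_lt_two).comp ?_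
    exact (tendsto_pow_atTop (by omega)).comp (tendsto_add_atTop_nat 1)
  obtain ⟨k₀, hk₀⟩ := eventually_atTop.1
    (hrec.and (hN.eventually (eventually_bounds_of_isEquivalent_log_rpow hg)))
  set M := 2 * C₀ * Real.exp R with hM
  have hM0 : 0 < M := by positivity
  set c₂ := 1 / 2 * (c * Real.log 2) ^ γ with hc₂
  refine ⟨C₃ * Real.exp R + (1 + Real.exp R + 12 * C₂ + 6 * M ^ 2), c, by positivity, hc, ?_⟩
  have hr₀ : 0 < min (min r₁ r₂) (min r₃ 1) := by positivity
  have hsqrt : Tendsto (fun n : ℕ => √(n : ℝ)) atTop atTop :=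
    Real.tendsto_sqrt_atTop.comp tendsto_natCast_atTop_atTop
  filter_upwards [hscale k₀, eventually_exp_neg_threshold_le hd R hr₀, eventually_ge_atTop 1,
    hsqrt.eventually_ge_atTop (2 * M), eventually_log_rpow_le_sqrt γ,
    -- The exponent covers `2 q` for `4 ^ j`, one for `r⁻¹`, and two for the desired `n⁻²`.
    eventually_le_one_div_pow_of_isBigO h0 h1 hβ hγ hγβ (by positivity : 0 < c₂) hΘ (2 * q + 3)]
    with n hnk hnr hn1 hnM hnlog hnΘ
  obtain ⟨k, hk, hkn, hck, hkl⟩ := hnk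
  refine ⟨k, hck, hkl, fun u hu => ?_⟩
  obtain ⟨hrec', hglow, hgupp⟩ := hk₀ k hk
  have hn0 : (0 : ℝ) < n := by positivity
  have hn1' : (1 : ℝ) ≤ n := by exact_mod_cast hn1
  have hw0 : 0 < √(n : ℝ) := Real.sqrt_pos.2 hn0
  have hww : √(n : ℝ) * √(n : ℝ) = n := Real.mul_self_sqrt hn0.le
  obtain ⟨r, hr⟩ : ∃ r, r = Real.exp (-threshold d n u) := ⟨_, rfl⟩
  have hr0 : 0 < r := hr ▸ Real.exp_pos _
  have hrr := hnr u hu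
  obtain ⟨hrd, hrd'⟩ := exp_neg_threshold_pow_le hd hn1 hu
  rw [← hr] at hrr hrd hrd'
  obtain ⟨⟨hrr1, hrr2⟩, hrr3, hrr4⟩ : (r ≤ r₁ ∧ r ≤ r₂) ∧ r ≤ r₃ ∧ r ≤ 1 := by
    simpa only [le_min_iff] using hrr
  rw [log_two_pow_pow] at hglow hgupp
  have hlogn : 0 ≤ Real.log n := Real.log_natCast_nonneg n
  -- The longest gap for which returns are controlled by the recurrence set. It is at most `2 √n`,
  -- and `t + 1` is still at least `c₂ (log n) ^ γ`.
  set t := ⌊g (2 ^ ((k + 1) ^ a))⌋₊ with ht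
  have hpos : 0 ≤ (((k : ℝ) + 1) ^ a * Real.log 2) ^ γ := by positivity
  have htg : (t : ℝ) ≤ g (2 ^ ((k + 1) ^ a)) := Nat.floor_le (by linarith)
  have ht2 : (t : ℝ) ≤ 2 * √n := by
    have : (((k : ℝ) + 1) ^ a * Real.log 2) ^ γ ≤ Real.log n ^ γ := by gcongr
    linarith
  have hΘt : Θ (t + 1) ≤ 1 / (n : ℝ) ^ (2 * q + 3) := by
    refine hnΘ (t + 1) ?_
    have e1 : (c * Real.log 2) ^ γ * Real.log n ^ γ ≤ (((k : ℝ) + 1) ^ a * Real.log 2) ^ γ := by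
      rw [← Real.mul_rpow (by positivity) hlogn]
      have : c * Real.log 2 * Real.log n ≤ ((k : ℝ) + 1) ^ a * Real.log 2 := by
        have := mul_le_mul_of_nonneg_right hck hl2.le
        linarith
      gcongr
    have e2 := Nat.lt_floor_add_one (g (2 ^ ((k + 1) ^ a)))
    rw [← ht] at e2
    push_cast
    rw [hc₂]
    linarith
  set j := q * Nat.log 2 n with hj
  obtain ⟨hq1, hq2⟩ := hq n hn1
  have hs0 : 0 < r / 4 ^ j := by positivity
  have hann' : ν.real (annulus x₀ r (r / 4 ^ j)) ≤ 4 * C₂ / (n : ℝ) ^ 2 := by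
    refine (hann r hr0 hrr2 j).trans ?_
    calc C₂ * θ ^ j ≤ C₂ * (4 / (n : ℝ) ^ 2) := by gcongr
      _ = _ := by ring
  have hsinv : 1 + (r / 4 ^ j)⁻¹ ≤ (1 + Real.exp R) * (n : ℝ) ^ (2 * q + 1) := by
    have e1 : r⁻¹ ≤ Real.exp R * n := by
      -- Since `r ≤ 1`, the lower bound for `r ^ d` is one for `r`.
      have : Real.exp (-R) / n ≤ r := hrd'.trans (pow_le_of_le_one hr0.le hrr4 (by omega))
      rw [inv_le_comm₀ hr0 (by positivity), mul_inv, ← Real.exp_neg]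
      exact this
    have e2 : (r / 4 ^ j)⁻¹ ≤ Real.exp R * (n : ℝ) ^ (2 * q + 1) := by
      rw [inv_div, div_eq_mul_inv]
      calc (4 : ℝ) ^ j * r⁻¹ ≤ (n : ℝ) ^ (2 * q) * (Real.exp R * n) := by gcongr
        _ = _ := by ring
    have e3 : 1 ≤ (n : ℝ) ^ (2 * q + 1) := one_le_pow₀ hn1'
    linarith
  have hmixt : Θ (t + 1) * (1 + (r / 4 ^ j)⁻¹) ≤ (1 + Real.exp R) / (n : ℝ) ^ 2 := by
    calc Θ (t + 1) * (1 + (r / 4 ^ j)⁻¹)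
        ≤ 1 / (n : ℝ) ^ (2 * q + 3) * ((1 + Real.exp R) * (n : ℝ) ^ (2 * q + 1)) := by
          gcongr
      _ = _ := by
          rw [show 2 * q + 3 = (2 * q + 1) + 2 by ring, pow_add _ _ 2]
          field_simp
  have hball : ν.real (closedEBall x₀ (ENNReal.ofReal r)) ≤ M / n := by
    refine (hdens r ⟨hr0, hrr1⟩).trans ?_
    calc 2 * C₀ * r ^ d ≤ 2 * C₀ * (Real.exp R / n) := by gcongr
      _ = M / n := by rw [hM]; ring
  have hτ : n * ν.real (closedEBall x₀ (ENNReal.ofReal r)) ≤ M := by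
    rw [le_div_iff₀ hn0] at hball
    linarith
  have hret : ν.real (eball x₀ (ENNReal.ofReal r) ∩
      {x | ∃ j, 1 ≤ j ∧ j ≤ t ∧ f^[j] x ∈ eball x₀ (ENNReal.ofReal r)}) ≤
      C₃ * lam k * (Real.exp R / n) := by
    refine (measureReal_mono (eball_inter_return_subset_recurrenceSet
      (N := 2 ^ ((k + 1) ^ a)) hd hr0.le ?_ Nat.one_le_two_pow htg)).trans
      ((hrec' r hr0 hrr3).trans ?_)
    · push_cast
      calc (2 * r) ^ d * 2 ^ ((k + 1) ^ a) ≤ 2 ^ d * (Real.exp R / n) * 2 ^ ((k + 1) ^ a) := by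
            rw [mul_pow]
            gcongr
        _ = 2 ^ d * Real.exp R * 2 ^ ((k + 1) ^ a) / n := by ring
        _ ≤ 1 := (div_le_one hn0).2 hkn
    · have := hlam k
      gcongr
  refine (abs_maxProb_sub_sqrtApprox_le hmix hf x₀ hn1 hr hs0 t hret (by linarith)).trans ?_
  have hU0 : 0 ≤ ν.real (closedEBall x₀ (ENNReal.ofReal r)) := measureReal_nonneg
  have hta : (t : ℝ) * ν.real (closedEBall x₀ (ENNReal.ofReal r)) ^ 2 ≤
      2 * √n * (M / n) ^ 2 := by gcongr
  have hτ2 : 4 * (n * ν.real (closedEBall x₀ (ENNReal.ofReal r))) ^ 2 / √(n : ℝ) ≤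
      4 * M ^ 2 / √n := by gcongr
  refine le_trans ?_ (error_terms_le hn1' (Real.exp_pos R).le hC₂.le hC₃.le (hlam k))
  gcongr

end ErrorAsymptotics

/-! ### Almost sure rates and the Gumbel limit. -/

section MainEstimates

open Set Metric

variable {X : Type*} [EMetricSpace X] [MeasurableSpace X] {f : X → X}
  {ν : Measure X} [IsProbabilityMeasure ν] {d : ℕ}

/-- Serves the finitely many `n` not covered by the asymptotics. There the base `1 - τ_n / √n` may
be negative, but the real power is still bounded by the power of the absolute value, and `τ_n ≤ n`.
-/
theorem abs_maxProb_sub_sqrtApprox_le_one_add (x₀ : X) {n : ℕ} (hn : 1 ≤ n) (u : ℝ) :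
    |maxProb d f ν x₀ n u - sqrtApprox d ν x₀ n u| ≤ 1 + √(n : ℝ) ^ √(n : ℝ) := by
  have hw : 1 ≤ √(n : ℝ) := Real.one_le_sqrt.2 (by exact_mod_cast hn)
  have hw0 : 0 < √(n : ℝ) := by linarith
  have hτ0 : 0 ≤ tau d ν x₀ n u := mul_nonneg (Nat.cast_nonneg n) measureReal_nonneg
  have hτn : tau d ν x₀ n u ≤ n := mul_le_of_le_one_right (Nat.cast_nonneg n) measureReal_le_one
  have h1 : |1 - tau d ν x₀ n u / √(n : ℝ)| ≤ √(n : ℝ) := by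
    have h2 : tau d ν x₀ n u / √(n : ℝ) ≤ √(n : ℝ) := by
      rw [div_le_iff₀ hw0, Real.mul_self_sqrt (Nat.cast_nonneg n)]
      exact hτn
    have h3 : 0 ≤ tau d ν x₀ n u / √(n : ℝ) := by positivity
    rw [abs_le]
    constructor <;> linarith
  have h4 : |sqrtApprox d ν x₀ n u| ≤ √(n : ℝ) ^ √(n : ℝ) :=
    (Real.abs_rpow_le_abs_rpow _ _).trans (Real.rpow_le_rpow (abs_nonneg _) h1 hw0.le)
  have h5 : |maxProb d f ν x₀ n u| ≤ 1 := by
    rw [maxProb, abs_of_nonneg measureReal_nonneg]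
    exact measureReal_le_one
  exact (abs_sub _ _).trans (add_le_add h5 h4)

/-- A bound for large `n`, uniform in `|u| ≤ R`, extends to all `n ≥ 2`. -/
theorem exists_forall_abs_maxProb_sub_sqrtApprox_le {x₀ : X} {R : ℝ} {h : ℕ → ℝ}
    (hpos : ∀ n, 2 ≤ n → 0 < h n)
    (hev : ∃ C : ℝ, ∀ᶠ n : ℕ in atTop, ∀ u : ℝ, |u| ≤ R →
      |maxProb d f ν x₀ n u - sqrtApprox d ν x₀ n u| ≤ C * h n) :
    ∃ C : ℝ, 0 < C ∧ ∀ n : ℕ, 2 ≤ n → ∀ u : ℝ, |u| ≤ R →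
      |maxProb d f ν x₀ n u - sqrtApprox d ν x₀ n u| ≤ C * h n := by
  obtain ⟨C, hC⟩ := hev
  obtain ⟨N, hN⟩ := eventually_atTop.1 hC
  set S := ∑ m ∈ Finset.range N, |(1 + √(m : ℝ) ^ √(m : ℝ)) / h m| with hS
  have hS0 : 0 ≤ S := Finset.sum_nonneg fun _ _ => abs_nonneg _
  refine ⟨|C| + 1 + S, by positivity, fun n hn u hu => ?_⟩
  have hh := hpos n hn
  rcases le_or_gt N n with hNn | hNn
  · refine (hN n hNn u hu).trans ?_
    gcongr
    linarith [le_abs_self C]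
  · refine (abs_maxProb_sub_sqrtApprox_le_one_add x₀ (by omega) u).trans ?_
    rw [← div_le_iff₀ hh]
    have h1 : |(1 + √(n : ℝ) ^ √(n : ℝ)) / h n| ≤ S :=
      Finset.single_le_sum (f := fun m : ℕ => |(1 + √(m : ℝ) ^ √(m : ℝ)) / h m|)
        (fun _ _ => abs_nonneg _) (Finset.mem_range.2 hNn)
    linarith [le_abs_self ((1 + √(n : ℝ) ^ √(n : ℝ)) / h n), abs_nonneg C]

theorem tendsto_exp_neg_threshold (hd : 1 ≤ d) (u : ℝ) :
    Tendsto (fun n : ℕ => Real.exp (-threshold d n u)) atTop (𝓝[>] 0) := by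
  refine tendsto_nhdsWithin_iff.2 ⟨?_, Eventually.of_forall fun n => Real.exp_pos _⟩
  refine Metric.tendsto_atTop.2 fun ε hε => ?_
  obtain ⟨N, hN⟩ := eventually_atTop.1
    (eventually_exp_neg_threshold_le hd |u| (half_pos hε))
  refine ⟨N, fun n hn => ?_⟩
  rw [Real.dist_eq, sub_zero, abs_of_pos (Real.exp_pos _)]
  linarith [hN n hn u le_rfl]

/-- Identifies the Gumbel constant as the limit density of `ν` on small balls, since `n = e^{-u} / r
^ d`. -/
theorem tendsto_tau {ν : Measure X} (hd : 1 ≤ d) {x₀ : X} {C : ℝ}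
    (hdens : Tendsto (fun r : ℝ => ν.real (closedEBall x₀ (ENNReal.ofReal r)) / r ^ d)
      (𝓝[>] 0) (𝓝 C)) (u : ℝ) :
    Tendsto (fun n : ℕ => tau d ν x₀ n u) atTop (𝓝 (C * Real.exp (-u))) := by
  refine ((hdens.comp (tendsto_exp_neg_threshold hd u)).mul_const (Real.exp (-u))).congr' ?_
  filter_upwards [eventually_ge_atTop 1] with n hn
  have hn0 : (n : ℝ) ≠ 0 := by positivity
  have he := (Real.exp_pos (-u)).ne'
  rw [Function.comp_apply, exp_neg_threshold_pow hd hn, tau, setOf_threshold_le_eq]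
  field_simp

theorem tendsto_sqrtApprox {ν : Measure X} (hd : 1 ≤ d) {x₀ : X} {C : ℝ}
    (hdens : Tendsto (fun r : ℝ => ν.real (closedEBall x₀ (ENNReal.ofReal r)) / r ^ d)
      (𝓝[>] 0) (𝓝 C)) (u : ℝ) :
    Tendsto (fun n : ℕ => sqrtApprox d ν x₀ n u) atTop
      (𝓝 (Real.exp (-(C * Real.exp (-u))))) := by
  have hτ := tendsto_tau hd hdens u
  have hsqrt : Tendsto (fun n : ℕ => √(n : ℝ)) atTop atTop :=
    Real.tendsto_sqrt_atTop.comp tendsto_natCast_atTop_atTop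
  have hexp := (Real.continuous_exp.tendsto _).comp hτ.neg
  have herr : Tendsto (fun n : ℕ => 2 * tau d ν x₀ n u ^ 2 / √(n : ℝ)) atTop (𝓝 0) :=
    ((hτ.pow 2).const_mul 2).div_atTop hsqrt
  have hdiff : Tendsto (fun n : ℕ => sqrtApprox d ν x₀ n u - Real.exp (-tau d ν x₀ n u)) atTop
      (𝓝 0) := by
    refine squeeze_zero_norm' ?_ herr
    filter_upwards [hsqrt.eventually_ge_atTop (2 * (C * Real.exp (-u) + 1)),
      hτ.eventually_le_const (lt_add_one _), eventually_ge_atTop 1] with n h1 h2 h3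
    exact abs_one_sub_div_rpow_sub_exp_le (mul_nonneg (Nat.cast_nonneg n) measureReal_nonneg)
      (Real.sqrt_pos.2 (by positivity)) (by linarith)
  simpa [Function.comp_def] using hdiff.add hexp

theorem gumbelLimit_of_tendsto_sub {ν : Measure X} (hd : 1 ≤ d) {x₀ : X}
    (hdens : ∃ C : ℝ, 0 < C ∧ Tendsto
      (fun r : ℝ => ν.real (closedEBall x₀ (ENNReal.ofReal r)) / r ^ d) (𝓝[>] 0) (𝓝 C))
    (hsub : ∀ u : ℝ, Tendsto
      (fun n : ℕ => maxProb d f ν x₀ n u - sqrtApprox d ν x₀ n u) atTop (𝓝 0)) :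
    GumbelLimit d f ν x₀ := by
  obtain ⟨C, hC, hdens⟩ := hdens
  refine ⟨C, hC, fun u => ?_⟩
  simpa using (hsub u).add (tendsto_sqrtApprox hd hdens u)

/-- For a system with good local geometry, stretched exponential mixing and quantitative recurrence
rates, the extreme value law at almost every point is approximated at every rate `h` dominating the
weighted recurrence rates along the scales `2 ^ (k + 1) ^ a`. -/
theorem HasBilipschitzCharts.ae_abs_maxProb_sub_sqrtApprox_le [BorelSpace X]
    [SecondCountableTopology X] (hX : HasBilipschitzCharts d X) (hlen : IsLengthSpace X) {δ : ℝ}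
    (hδ : 0 < δ) (hν : HasLpDensity (Measure.euclideanHausdorffMeasure d) ν δ) {Θ : ℕ → ℝ}
    (hmix : DecayOfCorrelations f ν Θ) (hf : MeasurePreserving f ν ν) (hd : 1 ≤ d) {θ₀ β γ : ℝ}
    (h0 : 0 < θ₀) (h1 : θ₀ < 1) (hβ : 0 < β) (hγ : 0 < γ) (hγβ : 1 < γ * β)
    (hΘ : Θ =O[atTop] fun n : ℕ => θ₀ ^ ((n : ℝ) ^ β)) {r : ℕ → ℝ} (hr : ∀ n, 2 ≤ n → 0 < r n)
    (hrec : LogScaleRecurrence d f ν γ r) {a : ℕ} (ha : 1 ≤ a) :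
    ∀ᵐ x₀ ∂ν, ∀ h : ℕ → ℝ, (∀ n, 2 ≤ n → 0 < h n) →
      (∀ c : ℝ, 0 < c → ∃ K : ℝ, ∀ᶠ n : ℕ in atTop, ∀ k : ℕ,
        c * Real.log n ≤ ((k : ℝ) + 1) ^ a → ((k : ℝ) + 1) ^ a * Real.log 2 ≤ Real.log n →
        ((k : ℝ) + 1) ^ 2 * r (2 ^ ((k + 1) ^ a)) + 1 / √(n : ℝ) ≤ K * h n) →
      (∀ R : ℝ, ∃ C₁ : ℝ, 0 < C₁ ∧ ∀ n : ℕ, 2 ≤ n → ∀ u : ℝ, |u| ≤ R →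
        |maxProb d f ν x₀ n u - sqrtApprox d ν x₀ n u| ≤ C₁ * h n) ∧
      (Tendsto h atTop (𝓝 0) → GumbelLimit d f ν x₀) := by
  have hac : ν ≪ Measure.euclideanHausdorffMeasure d := by
    obtain ⟨ρ, -, -, -, hρ⟩ := hν
    rw [hρ]
    exact withDensity_absolutelyContinuous _ _
  obtain ⟨g, -, hg, C, hC, hgC⟩ := hrec
  have hN2 : ∀ k : ℕ, 2 ≤ 2 ^ ((k + 1) ^ a) := fun k =>
    Nat.le_self_pow (by positivity) 2
  have hlam : ∀ k : ℕ, 0 < ((k : ℝ) + 1) ^ 2 * r (2 ^ ((k + 1) ^ a)) := fun k =>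
    mul_pos (by positivity) (hr _ (hN2 k))
  -- The weight `(k + 1) ^ 2` is there only to make this series converge.
  have hsum : Summable fun k : ℕ => ν.real (recurrenceSet d f g (2 ^ ((k + 1) ^ a))) /
      (((k : ℝ) + 1) ^ 2 * r (2 ^ ((k + 1) ^ a))) := by
    have hs : Summable fun k : ℕ => C * (1 / ((k : ℝ) + 1) ^ 2) := by
      have := (summable_nat_add_iff 1).2 (Real.summable_one_div_nat_pow.2 one_lt_two)
      exact (by simpa using this : Summable fun k : ℕ => 1 / ((k : ℝ) + 1) ^ 2).mul_left C
    refine hs.of_nonneg_of_le (fun k => div_nonneg measureReal_nonneg (hlam k).le) fun k => ?_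
    rw [div_le_iff₀ (hlam k)]
    refine (hgC _ (hN2 k)).trans_eq ?_
    field_simp
  filter_upwards [hX.ae_tendsto_measure_closedEBall_div hac, hX.ae_exists_annulus_le hlen hδ hν,
    hX.ae_eventually_measure_inter_le hac hlam hsum] with x₀ hdens hann hret h hh hdom
  have hmain : ∀ R : ℝ, ∃ C₁ : ℝ, 0 < C₁ ∧ ∀ n : ℕ, 2 ≤ n → ∀ u : ℝ, |u| ≤ R →
      |maxProb d f ν x₀ n u - sqrtApprox d ν x₀ n u| ≤ C₁ * h n := by
    intro R
    obtain ⟨C', c, hC', hc, hev⟩ := exists_eventually_abs_maxProb_sub_sqrtApprox_le hmix hf hd h0 h1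
      hβ hγ hγβ hΘ hg ha (fun k => (hlam k).le) hdens hann hret R
    obtain ⟨K, hK⟩ := hdom c hc
    refine exists_forall_abs_maxProb_sub_sqrtApprox_le hh ⟨C' * K, ?_⟩
    filter_upwards [hev, hK] with n ⟨k, hk1, hk2, hk3⟩ hK u hu
    refine (hk3 u hu).trans ?_
    rw [mul_assoc]
    exact mul_le_mul_of_nonneg_left (hK k hk1 hk2) hC'.le
  refine ⟨hmain, fun hlim => gumbelLimit_of_tendsto_sub hd hdens fun u => ?_⟩
  obtain ⟨C₁, -, hC₁⟩ := hmain |u|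
  refine squeeze_zero_norm' ?_ (by simpa using hlim.const_mul C₁)
  filter_upwards [eventually_ge_atTop 2] with n hn
  exact hC₁ n hn u le_rfl

/-- Polynomial recurrence rates along the scales `2 ^ (k + 1) ^ a`. -/
theorem exists_eventually_weak_rate_le {a : ℕ} {α σ κ c : ℝ} (hα : 0 < α) (hσ : 0 < σ)
    (ha : 2 ≤ a * σ) (hκ : σ ≤ κ) (hc : 0 < c) :
    ∃ K : ℝ, ∀ᶠ n : ℕ in atTop, ∀ k : ℕ,
      c * Real.log n ≤ ((k : ℝ) + 1) ^ a → ((k : ℝ) + 1) ^ a * Real.log 2 ≤ Real.log n →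
      ((k : ℝ) + 1) ^ 2 * (1 / Real.log ((2 ^ ((k + 1) ^ a) : ℕ) : ℝ) ^ α) + 1 / √(n : ℝ) ≤
        K * (1 / Real.log n ^ (α - κ)) := by
  have hl2 : 0 < Real.log 2 := Real.log_pos one_lt_two
  set A := (1 / Real.log 2) ^ σ * (1 / (c * Real.log 2) ^ α) with hA
  have hA0 : 0 ≤ A := by positivity
  refine ⟨A + 1, ?_⟩
  filter_upwards [tendsto_log_natCast_atTop.eventually_ge_atTop 1,
    eventually_log_rpow_le_sqrt (α - κ)] with n hn hs k h1 h2
  have hL0 : 0 < Real.log n := by linarith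
  rw [log_two_pow_pow, add_mul, one_mul]
  refine add_le_add ?_ (one_div_le_one_div_of_le (Real.rpow_pos_of_pos hL0 _) hs)
  -- As `(k + 1) ^ a` is at most `log n / log 2` and `a σ ≥ 2`, the weight costs only `(log n) ^ σ`.
  have e1 : ((k : ℝ) + 1) ^ 2 ≤ (1 / Real.log 2) ^ σ * Real.log n ^ σ := by
    rw [← Real.mul_rpow (by positivity) hL0.le]
    calc ((k : ℝ) + 1) ^ 2 = ((k : ℝ) + 1) ^ (2 : ℝ) := (Real.rpow_two _).symm
      _ ≤ ((k : ℝ) + 1) ^ (a * σ) :=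
        Real.rpow_le_rpow_of_exponent_le (by linarith [(Nat.cast_nonneg k : (0 : ℝ) ≤ k)]) ha
      _ = (((k : ℝ) + 1) ^ a) ^ σ := by rw [Real.rpow_mul (by positivity), Real.rpow_natCast]
      _ ≤ (1 / Real.log 2 * Real.log n) ^ σ := by
        refine Real.rpow_le_rpow (by positivity) ?_ hσ.le
        rwa [one_div_mul_eq_div, le_div_iff₀ hl2]
  have e2 : 1 / (((k : ℝ) + 1) ^ a * Real.log 2) ^ α ≤
      1 / (c * Real.log 2) ^ α * (1 / Real.log n ^ α) := by
    rw [one_div_mul_one_div, ← Real.mul_rpow (by positivity) hL0.le]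
    refine one_div_le_one_div_of_le (by positivity) (Real.rpow_le_rpow (by positivity) ?_ hα.le)
    have := mul_le_mul_of_nonneg_right h1 hl2.le
    linarith
  calc _ ≤ (1 / Real.log 2) ^ σ * Real.log n ^ σ *
        (1 / (c * Real.log 2) ^ α * (1 / Real.log n ^ α)) := by gcongr
    _ = A * (Real.log n ^ σ * (1 / Real.log n ^ α)) := by rw [hA]; ring
    _ ≤ A * (Real.log n ^ κ * (1 / Real.log n ^ α)) := by gcongr
    _ = A * (1 / Real.log n ^ (α - κ)) := by
        rw [Real.rpow_sub hL0, one_div_div, mul_one_div]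

/-- Stretched exponential recurrence rates along the scales `2 ^ (k + 1)`. -/
theorem exists_eventually_intermediate_rate_le {α c : ℝ} (hα : 0 < α) (hα1 : α < 1) (hc : 0 < c) :
    ∃ K : ℝ, ∀ᶠ n : ℕ in atTop, ∀ k : ℕ,
      c * Real.log n ≤ ((k : ℝ) + 1) ^ 1 → ((k : ℝ) + 1) ^ 1 * Real.log 2 ≤ Real.log n →
      ((k : ℝ) + 1) ^ 2 * Real.exp (-(Real.log ((2 ^ ((k + 1) ^ 1) : ℕ) : ℝ) ^ α)) + 1 / √(n : ℝ) ≤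
        K * Real.exp (-(Real.log n ^ (α / 2))) := by
  have hl2 : 0 < Real.log 2 := Real.log_pos one_lt_two
  set b := (c * Real.log 2) ^ α with hb
  have hb0 : 0 < b := by positivity
  refine ⟨(1 / Real.log 2) ^ 2 + 1, ?_⟩
  have hL := tendsto_log_natCast_atTop
  have hlog : ∀ᶠ n : ℕ in atTop, Real.log (Real.log n) ≤ Real.log n ^ (α / 2) := by
    filter_upwards [hL.eventually ((isLittleO_log_rpow_atTop (half_pos hα)).bound one_pos),
      hL.eventually_ge_atTop 0] with n hn hn0
    rw [one_mul, Real.norm_of_nonneg (Real.rpow_nonneg hn0 _)] at hn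
    exact (le_abs_self _).trans hn
  filter_upwards [hL.eventually_ge_atTop 4, hlog, eventually_ge_atTop 1,
    ((tendsto_rpow_atTop (half_pos hα)).comp hL).eventually_ge_atTop (3 / b)]
    with n hn hs hn1 hz k h1 h2
  have hL0 : 0 < Real.log n := by linarith
  have hn0 : (0 : ℝ) < n := by positivity
  rw [log_two_pow_pow, pow_one, add_mul (_ ^ 2) 1, one_mul]
  rw [pow_one] at h1 h2
  set z := Real.log n ^ (α / 2) with hzdef
  have hz0 : 0 < z := by positivity
  have hzz : Real.log n ^ α = z * z := by
    rw [hzdef, ← Real.rpow_add hL0, add_halves]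
  refine add_le_add ?_ ?_
  · have e1 : ((k : ℝ) + 1) ^ 2 ≤ (1 / Real.log 2) ^ 2 * Real.exp (2 * z) := by
      have e : (k : ℝ) + 1 ≤ 1 / Real.log 2 * Real.exp z := by
        rw [one_div_mul_eq_div, le_div_iff₀ hl2]
        refine h2.trans ?_
        rw [← Real.log_le_iff_le_exp hL0]
        exact hs
      calc ((k : ℝ) + 1) ^ 2 ≤ (1 / Real.log 2 * Real.exp z) ^ 2 := by gcongr
        _ = _ := by rw [mul_pow, ← Real.exp_nat_mul]; norm_num
    -- With `z = (log n) ^ (α/2)` the exponent is at least `b z²`, hence eventually `3 z`; two of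
    -- these pay for the weight `(k + 1) ^ 2` and one remains. Halving `α` is what absorbs the
    -- constant `b`.
    have e2 : Real.exp (-((((k : ℝ) + 1) * Real.log 2) ^ α)) ≤ Real.exp (-(3 * z)) := by
      refine Real.exp_le_exp.2 (neg_le_neg ?_)
      have e : b * Real.log n ^ α ≤ (((k : ℝ) + 1) * Real.log 2) ^ α := by
        rw [hb, ← Real.mul_rpow (by positivity) hL0.le]
        refine Real.rpow_le_rpow (by positivity) ?_ hα.le
        have := mul_le_mul_of_nonneg_right h1 hl2.le
        linarith
      refine le_trans ?_ e
      rw [hzz, ← mul_assoc]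
      refine mul_le_mul_of_nonneg_right ?_ hz0.le
      have : 3 / b ≤ z := hz
      rw [div_le_iff₀ hb0] at this
      linarith
    calc _ ≤ (1 / Real.log 2) ^ 2 * Real.exp (2 * z) * Real.exp (-(3 * z)) := by gcongr
      _ = (1 / Real.log 2) ^ 2 * Real.exp (-z) := by
        rw [mul_assoc, ← Real.exp_add]
        congr 2
        ring
  · have e1 : z ≤ Real.log n / 2 := by
      have e2 : z ≤ √(Real.log n) := by
        rw [Real.sqrt_eq_rpow]
        exact Real.rpow_le_rpow_of_exponent_le (by linarith) (by linarith)
      have e3 : 2 ≤ √(Real.log n) := Real.le_sqrt_of_sq_le (by linarith)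
      nlinarith [Real.mul_self_sqrt hL0.le]
    rw [← Real.exp_log (Real.sqrt_pos.2 hn0), Real.log_sqrt hn0.le, one_div, ← Real.exp_neg]
    exact Real.exp_le_exp.2 (neg_le_neg e1)

end MainEstimates

theorem theorem1 (δ : ℝ) (hδ : 0 < δ) :
    ∃ C₂ : ℝ, 0 < C₂ ∧
      ∀ (d : ℕ) (_ : 1 ≤ d)
        (H : Type*) [TopologicalSpace H] (I : ModelWithCorners ℝ (EuclideanSpace ℝ (Fin d)) H)
        (X : Type*) [EMetricSpace X] [SecondCountableTopology X]
        [ChartedSpace H X] [IsManifold I ∞ X]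
        [Bundle.RiemannianBundle (fun x : X => TangentSpace I x)]
        [IsContMDiffRiemannianBundle I ∞ (EuclideanSpace ℝ (Fin d))
          (fun x : X => TangentSpace I x)]
        [IsRiemannianManifold I X]
        [MeasurableSpace X] [BorelSpace X]
        (f : X → X) (ν : Measure X) [IsProbabilityMeasure ν]
        (_ : Ergodic f ν)
        (_ : HasLpDensity (Measure.euclideanHausdorffMeasure d) ν δ)
        (_ : IsNonUniformlyExpanding I f ν)
        (Θ : ℕ → ℝ) (_ : DecayOfCorrelations f ν Θ)
        (θ₀ β : ℝ) (_ : 0 < θ₀) (_ : θ₀ < 1) (_ : 0 < β) (_ : β ≤ 1)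
        (_ : Θ =O[atTop] fun n : ℕ => θ₀ ^ ((n : ℝ) ^ β))
        (γ : ℝ) (_ : 1 < γ) (_ : 1 < γ * β),
        (∀ α : ℝ, 0 < α → WeakRecurrence d f ν γ α →
          (∀ᵐ x₀ ∂ν, ∀ κ : ℝ, C₂ / β < κ → ∀ R : ℝ, ∃ C₁ : ℝ, 0 < C₁ ∧
            ∀ n : ℕ, 2 ≤ n → ∀ u : ℝ, |u| ≤ R →
              |maxProb d f ν x₀ n u - sqrtApprox d ν x₀ n u| ≤
                C₁ / Real.log n ^ (α - κ)) ∧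
          ∀ᵐ x₀ ∂ν, GumbelLimit d f ν x₀) ∧
        (∀ α : ℝ, 0 < α → α < 1 → IntermediateRecurrence d f ν γ α →
          (∃ α' : ℝ, 0 < α' ∧
            ∀ᵐ x₀ ∂ν, ∀ R : ℝ, ∃ C₁ : ℝ, 0 < C₁ ∧
              ∀ n : ℕ, 2 ≤ n → ∀ u : ℝ, |u| ≤ R →
                |maxProb d f ν x₀ n u - sqrtApprox d ν x₀ n u| ≤
                  C₁ * Real.exp (-(Real.log n ^ α'))) ∧
          ∀ᵐ x₀ ∂ν, GumbelLimit d f ν x₀) := by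
  -- Since `β ≤ 1`, the condition on `κ` becomes `κ > 1`, more than the loss `σ ≤ 1` below.
  refine ⟨1, one_pos, ?_⟩
  intro d hd H _ I X _ _ _ _ _ _ _ _ _ f ν _ herg hν _ Θ hmix θ₀ β h0 h1 hβ hβ1 hΘ γ hγ hγβ
  have : IsManifold I 1 X := IsManifold.of_le (n := ∞) (by simp)
  have : IsContinuousRiemannianBundle (EuclideanSpace ℝ (Fin d))
      (fun x : X => TangentSpace I x) := by
    obtain ⟨g, hg, hg'⟩ := IsContMDiffRiemannianBundle.exists_contMDiff (IB := I) (n := ∞)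
      (F := EuclideanSpace ℝ (Fin d)) (E := fun x : X => TangentSpace I x)
    exact ⟨g, hg.continuous, hg'⟩
  have hX : HasBilipschitzCharts d X := fun K hK => exists_countable_bilipschitz_charts I hK
  have hlen : IsLengthSpace X := fun x y s ε hs hfin hε =>
    exists_edist_eq_and_add_le (I := I) hs hfin hε
  have hf := herg.toMeasurePreserving
  have hγ0 : 0 < γ := by linarith
  have hL := tendsto_log_natCast_atTop
  have hlog : ∀ n : ℕ, 2 ≤ n → 0 < Real.log n := fun n hn =>
    Real.log_pos (by exact_mod_cast hn)
  constructor
  · intro α hα hrec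
    -- `σ ≤ 1` puts the loss below every admissible `κ`; `σ ≤ α / 2` keeps `α - σ` positive, so the
    -- error tends to zero and the Gumbel limit follows even when `κ` exceeds `α`.
    set σ := min 1 (α / 2) with hσ
    have hσ0 : 0 < σ := by positivity
    have hσ1 : σ ≤ 1 := min_le_left _ _
    have hσα : σ ≤ α / 2 := min_le_right _ _
    obtain ⟨a, ha⟩ := exists_nat_ge (2 / σ)
    have ha2 : 2 ≤ a * σ := (div_le_iff₀ hσ0).1 ha
    have ha1 : 1 ≤ a := Nat.one_le_iff_ne_zero.2 fun h => by
      rw [h, Nat.cast_zero, zero_mul] at ha2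
      linarith
    have hpos : ∀ κ : ℝ, ∀ n : ℕ, 2 ≤ n → 0 < 1 / Real.log n ^ (α - κ) := fun κ n hn =>
      one_div_pos.2 (Real.rpow_pos_of_pos (hlog n hn) _)
    have hmain := hX.ae_abs_maxProb_sub_sqrtApprox_le hlen hδ hν hmix hf hd h0 h1 hβ hγ0 hγβ hΘ
      (fun n hn => one_div_pos.2 (Real.rpow_pos_of_pos (hlog n hn) _)) hrec ha1
    constructor
    -- The full-measure set is fixed before the rate `h`, so one null set serves all of the
    -- uncountably many `κ`.
    · filter_upwards [hmain] with x₀ hx κ hκ R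
      have hκ1 : 1 < κ := ((one_le_div hβ).2 hβ1).trans_lt hκ
      obtain ⟨C, hC, hb⟩ := (hx _ (hpos κ) fun c hc =>
        exists_eventually_weak_rate_le hα hσ0 ha2 (hσ1.trans hκ1.le) hc).1 R
      refine ⟨C, hC, fun n hn u hu => (hb n hn u hu).trans_eq (mul_one_div _ _)⟩
    · filter_upwards [hmain] with x₀ hx
      refine (hx _ (hpos σ) fun c hc =>
        exists_eventually_weak_rate_le hα hσ0 ha2 le_rfl hc).2 ?_
      exact tendsto_const_nhds.div_atTop ((tendsto_rpow_atTop (by linarith)).comp hL)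
  · intro α hα hα1 hrec
    have hmain := hX.ae_abs_maxProb_sub_sqrtApprox_le hlen hδ hν hmix hf hd h0 h1 hβ hγ0 hγβ hΘ
      (fun n _ => Real.exp_pos _) hrec le_rfl
    have hdom := fun (c : ℝ) (hc : 0 < c) => exists_eventually_intermediate_rate_le hα hα1 hc
    constructor
    · refine ⟨α / 2, half_pos hα, ?_⟩
      filter_upwards [hmain] with x₀ hx
      exact (hx _ (fun n _ => Real.exp_pos _) hdom).1
    · filter_upwards [hmain] with x₀ hx
      refine (hx _ (fun n _ => Real.exp_pos _) hdom).2 ?_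
      exact Real.tendsto_exp_neg_atTop_nhds_zero.comp
        ((tendsto_rpow_atTop (half_pos hα)).comp hL)
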